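/- All graphs are finite and simple. For a graph $G$, write $|G|$, $\delta(G)$ and $\alpha(G)$ for its number of vertices, its minimum degree and its independence number (the maximum size of a set of pairwise non-adjacent vertices). An orientation of $G$ is a digraph $D$ obtained from $G$ by replacing each edge by exactly one of its two possible arcs. If $D$ has $m$ arcs and $\tau$ is a bijection from the arc set of $D$ to $\{1,\dots,m\}$, the vertex-sum of a vertex $u$ is the sum of the labels $\tau(e)$ of all arcs $e$ entering $u$ minus the sum of the labels of all arcs leaving $u$ (so it is $0$ if $u$ is isolated). We say that $G$ has an antimagic orientation if there are an orientation $D$ of $G$ and such a bijection $\tau$ for which distinct vertices have distinct vertex-sums. **Theorem 1.5.** Let $G$ be a connected graph. (i) If $\alpha(G)\le 2$, then $G$ has an antimagic orientation. (ii) If $\alpha(G)=3$ and $|G|\ge 13$, then $G$ has an antimagic orientation. (iii) If $\alpha(G)=4$ and $\delta(G)\ge 11$, then $G$ has an antimagic orientation. -/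

import Mathlib

/-- The set of arcs of a digraph; the pair `(u, v)` is the arc leaving `u` and entering `v`. -/
def Digraph.arcs {V : Type*} (D : Digraph V) : Set (V × V) :=
  {p | D.Adj p.1 p.2}

open Classical in
/-- The vertex-sum of `u` in `D` under the arc labeling `τ`: the sum of the labels of all arcs
entering `u` minus the sum of the labels of all arcs leaving `u`, as an integer. Only the values
of `τ` on the arcs of `D` matter; the vertex-sum of an isolated vertex is `0` (empty sums). -/
noncomputable def Digraph.vertexSum {V : Type*} [Fintype V] (D : Digraph V) (τ : V × V → ℕ)
    (u : V) : ℤ :=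
  (∑ v : V with D.Adj v u, (τ (v, u) : ℤ)) - ∑ v : V with D.Adj u v, (τ (u, v) : ℤ)

/-- `τ` is an antimagic labeling of the digraph `D` with `m` arcs: it restricts to a bijection from
the arcs of `D` onto `{1, …, m}`, and distinct vertices have distinct vertex-sums. -/
def Digraph.IsAntimagicLabeling {V : Type*} [Fintype V] (D : Digraph V) (τ : V × V → ℕ) : Prop :=
  Set.BijOn τ D.arcs (Set.Icc 1 D.arcs.ncard) ∧
    ∀ u v : V, u ≠ v → D.vertexSum τ u ≠ D.vertexSum τ v

/-- `D` is an orientation of the simple graph `G`: it has the vertices of `G`, every edge of `G`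
gives an arc in exactly one of its two directions, and there are no other arcs. -/
def SimpleGraph.IsOrientation {V : Type*} (G : SimpleGraph V) (D : Digraph V) : Prop :=
  (∀ u v : V, G.Adj u v ↔ D.Adj u v ∨ D.Adj v u) ∧ ∀ u v : V, D.Adj u v → ¬ D.Adj v u

/-- `G` has an antimagic orientation: some orientation of `G` has an antimagic labeling. -/
def SimpleGraph.HasAntimagicOrientation {V : Type*} [Fintype V] (G : SimpleGraph V) : Prop :=
  ∃ (D : Digraph V) (τ : V × V → ℕ), G.IsOrientation D ∧ D.IsAntimagicLabeling τ

/-! Let `S` be an independent dominating set, `m` the number of edges, `k` the number of vertices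
outside `S`, and `M = m - k`. Orient every edge at `S` out of `S`, so that the sums on `S` are at
most `0`. Reserve for each vertex outside `S` one edge to `S`; these `k` edges get the largest
labels `M + 1, …, m`. The edges avoiding `S` are cut into trails, labeled decreasingly along each,
so that they contribute at least `-M` at every vertex (`exists_isLabeling_netSum_ge`). Giving the
reserved labels out in the order of the partial sums makes the sums outside `S` positive and
distinct (`exists_labels_of_dominating`).

Only the sums on `S` may still collide. Permuting the labels between an outside vertex and its
neighbors in `S` leaves all sums outside `S` unchanged, and moves weight within `S`. If `S` has at
most four vertices, connected through common neighbors, and `m` is large compared with `k`, then a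
few labels can be prescribed so that the possible moves have very different sizes, and some
combination of them separates the sums.

Such an `S` is grown greedily: while it does not dominate, connectedness yields an undominated
vertex sharing a neighbor with `S`. The independence number bounds the growth by four vertices. The
assumptions in (ii) and (iii) serve only to make `m` large enough. -/

/-! ### Labelings by trails, with net sums bounded below. -/

open Classical in
/-- `f u v` is the label of the arc from `u` to `v`, and `0` if there is no such arc; the arcs form an
orientation of `H`, labeled bijectively by `L`. -/
structure SimpleGraph.IsLabeling {V : Type*} (H : SimpleGraph V) (L : Finset ℕ) (f : V → V → ℕ) :
    Prop where
  adj_iff : ∀ u v, H.Adj u v ↔ f u v ≠ 0 ∨ f v u ≠ 0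
  asymm : ∀ u v, f u v ≠ 0 → f v u = 0
  bijOn : Set.BijOn (fun p : V × V => f p.1 p.2) {p | f p.1 p.2 ≠ 0} L

/-- The sum of the labels entering `u` minus the sum of those leaving `u`. -/
def netSum {V : Type*} [Fintype V] (f : V → V → ℕ) (u : V) : ℤ :=
  ∑ v, ((f v u : ℤ) - f u v)

namespace SimpleGraph

variable {V : Type*}

theorem IsLabeling.hasAntimagicOrientation [Fintype V] {G : SimpleGraph V} {N : ℕ} {f : V → V → ℕ}
    (h : G.IsLabeling (Finset.Icc 1 N) f) (hinj : Function.Injective (netSum f)) :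
    G.HasAntimagicOrientation := by
  classical
  refine ⟨⟨fun u v => f u v ≠ 0⟩, fun p => f p.1 p.2, ⟨h.adj_iff, ?_⟩, ?_, ?_⟩
  · intro u v huv hvu
    exact hvu (h.asymm u v huv)
  · have hb := h.bijOn
    have hc : Digraph.arcs ⟨fun u v => f u v ≠ 0⟩ = {p : V × V | f p.1 p.2 ≠ 0} := rfl
    have hn : Set.ncard {p : V × V | f p.1 p.2 ≠ 0} = N := by
      rw [← hb.injOn.ncard_image, hb.image_eq, Set.ncard_coe_finset]
      simp
    rw [hc, hn]
    simpa using hb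
  · have key : ∀ u, Digraph.vertexSum ⟨fun u v => f u v ≠ 0⟩ (fun p => f p.1 p.2) u
        = netSum f u := by
      intro u
      simp only [Digraph.vertexSum, netSum, Finset.sum_sub_distrib]
      congr 1 <;>
      · rw [Finset.sum_filter]
        refine Finset.sum_congr rfl fun v _ => ?_
        split_ifs with hv
        · rfl
        · push Not at hv
          simp [hv]
    intro u v huv he
    rw [key, key] at he
    exact huv (hinj he)

theorem IsLabeling.netSum_eq_zero [Fintype V] {H : SimpleGraph V} {L : Finset ℕ} {f : V → V → ℕ}
    (h : H.IsLabeling L f) {u : V} (hu : ∀ v, ¬ H.Adj u v) : netSum f u = 0 := by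
  refine Finset.sum_eq_zero fun v _ => ?_
  have := hu v
  rw [h.adj_iff] at this
  push Not at this
  simp [this.1, this.2]

open Classical in
/-- Adding one arc. -/
theorem IsLabeling.add_arc [Fintype V] {H H' : SimpleGraph V} {L : Finset ℕ} {f : V → V → ℕ}
    (h : H.IsLabeling L f) {a b : V} (hab : a ≠ b) (hH : ¬ H.Adj a b)
    (hH' : ∀ u v, H'.Adj u v ↔ H.Adj u v ∨ s(u, v) = s(a, b)) {l : ℕ} (hl : l ∉ L) (hl0 : l ≠ 0) :
    ∃ g : V → V → ℕ, H'.IsLabeling (insert l L) g ∧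
      ∀ u, netSum g u = netSum f u + (if u = b then (l : ℤ) else 0) - if u = a then (l : ℤ) else 0 := by
  have hf : f a b = 0 ∧ f b a = 0 := by
    rw [h.adj_iff] at hH
    push Not at hH
    exact hH
  refine ⟨fun u v => if u = a ∧ v = b then l else f u v, ⟨?_, ?_, ?_⟩, ?_⟩
  · intro u v
    rw [hH', h.adj_iff, Sym2.eq_iff]
    grind
  · intro u v
    have := h.asymm u v
    grind
  · have e : {p : V × V | (if p.1 = a ∧ p.2 = b then l else f p.1 p.2) ≠ 0}
        = insert (a, b) {p : V × V | f p.1 p.2 ≠ 0} := by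
      ext ⟨u, v⟩
      simp only [Set.mem_ofPred_eq, Set.mem_insert_iff, Prod.mk.injEq]
      grind
    rw [e, Finset.coe_insert]
    have hb := h.bijOn
    have : Set.BijOn (fun p : V × V => if p.1 = a ∧ p.2 = b then l else f p.1 p.2)
        {p | f p.1 p.2 ≠ 0} L := by
      refine hb.congr ?_
      rintro ⟨u, v⟩ huv
      simp only [Set.mem_ofPred_eq] at huv ⊢
      grind
    have h2 := this.insert (a := (a, b)) (by simpa using hl)
    simpa using h2
  · intro u
    have : ∀ v, (((if v = a ∧ u = b then l else f v u : ℕ) : ℤ) - (if u = a ∧ v = b then l else f u v : ℕ))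
        = ((f v u : ℤ) - f u v) + (if v = a then (if u = b then (l : ℤ) else 0) else 0)
          - (if v = b then (if u = a then (l : ℤ) else 0) else 0) := by
      intro v
      grind
    simp only [netSum]
    rw [Finset.sum_congr rfl fun v _ => this v]
    rw [Finset.sum_sub_distrib, Finset.sum_add_distrib]
    simp

/-- Extending a labeling along a trail, with labels that decrease along the trail. -/
theorem IsLabeling.add_trail [Fintype V] {G H : SimpleGraph V} {L : Finset ℕ} {f : V → V → ℕ}
    (h : H.IsLabeling L f) {a b : V} (p : G.Walk a b) :
    p.IsTrail → (∀ e ∈ p.edges, e ∉ H.edgeSet) → ∀ (M : Finset ℕ) (B : ℕ), M.card = p.length →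
    Disjoint L M → 0 ∉ M → (∀ l ∈ M, l ≤ B) → ∀ H' : SimpleGraph V,
    (∀ u v, H'.Adj u v ↔ H.Adj u v ∨ s(u, v) ∈ p.edges) →
    open Classical in
    ∃ g : V → V → ℕ, H'.IsLabeling (L ∪ M) g ∧
      ∀ u, netSum f u - (if u = a then (B : ℤ) else 0) ≤ netSum g u := by
  classical
  induction p with
  | nil =>
    intro _ _ M B hM _ _ _ H' hH'
    have : H' = H := by
      ext u v
      simp [hH']
    subst this
    simp only [Walk.length_nil, Finset.card_eq_zero] at hM
    subst hM
    refine ⟨f, by simpa using h, fun u => ?_⟩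
    split_ifs <;> simp
  | @cons a c b hac p ih =>
    intro hp hpe M B hM hLM h0 hB H' hH'
    simp only [Walk.isTrail_cons] at hp
    have hne : M.Nonempty := by
      rw [← Finset.card_pos, hM]; simp
    -- The largest label goes on the first arc. The rest of the trail lowers the sum at its start
    -- `c` by at most `l`, and the arc into `c` pays this back.
    set l := M.max' hne with hl
    have hlM : l ∈ M := M.max'_mem hne
    obtain ⟨g, hg, hgs⟩ := ih hp.1 (fun e he => hpe e (by simp [he])) (M.erase l) l
      (by rw [Finset.card_erase_of_mem hlM, hM]; simp)
      (hLM.mono_right (Finset.erase_subset _ _))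
      (fun hh => h0 (Finset.mem_of_mem_erase hh))
      (fun x hx => M.le_max' x (Finset.mem_of_mem_erase hx))
      (H ⊔ fromEdgeSet {e | e ∈ p.edges})
      (by
        intro u v
        simp only [sup_adj, fromEdgeSet_adj, Set.mem_ofPred_eq]
        constructor
        · tauto
        · rintro (hh | hh)
          · exact Or.inl hh
          · exact Or.inr ⟨hh, (p.adj_of_mem_edges hh).ne⟩)
    obtain ⟨g', hg', hgs'⟩ := hg.add_arc (H' := H') (a := a) (b := c) (l := l) hac.ne
      (by
        simp only [sup_adj, fromEdgeSet_adj, Set.mem_ofPred_eq, not_or, not_and]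
        exact ⟨fun hh => hpe s(a, c) (by simp) hh, fun hh => absurd hh hp.2⟩)
      (by
        intro u v
        rw [hH']
        simp only [sup_adj, fromEdgeSet_adj, Set.mem_ofPred_eq, Walk.edges_cons, List.mem_cons]
        constructor
        · rintro (hh | hh | hh)
          · exact Or.inl (Or.inl hh)
          · exact Or.inr hh
          · exact Or.inl (Or.inr ⟨hh, (p.adj_of_mem_edges hh).ne⟩)
        · tauto)
      (by
        rw [Finset.mem_union, not_or]
        exact ⟨fun hh => (Finset.disjoint_left.mp hLM hh) hlM, by simp⟩)
      (fun hh => h0 (hh ▸ hlM))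
    refine ⟨g', ?_, fun u => ?_⟩
    · have : insert l (L ∪ M.erase l) = L ∪ M := by
        rw [← Finset.union_insert, Finset.insert_erase hlM]
      rwa [this] at hg'
    · rw [hgs']
      have h1 := hgs u
      have h2 : (l : ℤ) ≤ B := by exact_mod_cast hB l hlM
      split_ifs at h1 ⊢ <;> linarith

/-- Every graph has a labeling by `L` with all net sums at least `-B`, if `L` is bounded by `B`. -/
theorem exists_isLabeling_netSum_ge [Fintype V] (B : ℕ) (n : ℕ) :
    ∀ (H : SimpleGraph V) (L : Finset ℕ), H.edgeSet.ncard = n → L.card = n → 0 ∉ L →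
    (∀ l ∈ L, l ≤ B) → ∃ f : V → V → ℕ, H.IsLabeling L f ∧ ∀ u, -(B : ℤ) ≤ netSum f u := by
  classical
  induction n using Nat.strong_induction_on with
  | _ n ih =>
  intro H L hn hL h0 hB
  rcases Nat.eq_zero_or_pos n with hn0 | hpos
  · subst hn0
    have hH : ∀ u v, ¬ H.Adj u v := by
      intro u v huv
      rw [Set.ncard_eq_zero (Set.toFinite _)] at hn
      exact (Set.eq_empty_iff_forall_notMem.mp hn s(u, v)) huv
    rw [Finset.card_eq_zero] at hL
    subst hL
    refine ⟨fun _ _ => 0, ⟨by simpa using hH, by simp, by simp⟩, fun u => by simp [netSum]⟩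
  · obtain ⟨e, he⟩ : H.edgeSet.Nonempty := by
      rw [← Set.ncard_pos (Set.toFinite _), hn]; exact hpos
    induction e using Sym2.ind with
    | _ x y =>
    have hxy : H.Adj x y := he
    have : Nonempty V := ⟨x⟩
    -- No edge at the start `u` of a longest trail is left over, since it could be prepended. So
    -- `u`, the only vertex that loses, has sum `0` before the trail is added.
    obtain ⟨u, v, p, hp, hmax⟩ := Walk.exists_isTrail_forall_isTrail_length_le_length H
    have hlen : 1 ≤ p.length := by
      have := hmax x y hxy.toWalk (by simp)
      simpa using this
    have hcard : (H.deleteEdges {e | e ∈ p.edges}).edgeSet.ncard + p.length = n := by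
      rw [edgeSet_deleteEdges, ← hn]
      have h1 : Set.ncard {e | e ∈ p.edges} = p.length := by
        have : {e | e ∈ p.edges} = (p.edges.toFinset : Set (Sym2 V)) := by ext; simp
        rw [this, Set.ncard_coe_finset, List.toFinset_card_of_nodup hp.edges_nodup, p.length_edges]
      rw [← h1]
      exact Set.ncard_sdiff_add_ncard_of_subset fun e he => p.edges_subset_edgeSet he
    have hiso : ∀ w, ¬ (H.deleteEdges {e | e ∈ p.edges}).Adj u w := by
      intro w hw
      rw [deleteEdges_adj] at hw
      have := hmax w v (Walk.cons hw.1.symm p)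
        (by rw [Walk.isTrail_cons]; exact ⟨hp, by rw [Sym2.eq_swap]; exact hw.2⟩)
      simp at this
    obtain ⟨M, hML, hM⟩ := Finset.exists_subset_card_eq (s := L) (n := p.length) (by omega)
    obtain ⟨f, hf, hfs⟩ := ih (H.deleteEdges {e | e ∈ p.edges}).edgeSet.ncard (by omega)
      (H.deleteEdges {e | e ∈ p.edges}) (L \ M) rfl
      (by rw [Finset.card_sdiff_of_subset hML]; omega)
      (fun hh => h0 (Finset.mem_sdiff.mp hh).1) (fun l hl => hB l (Finset.mem_sdiff.mp hl).1)
    obtain ⟨g, hg, hgs⟩ := hf.add_trail p hp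
      (by
        intro e he
        rw [edgeSet_deleteEdges]
        exact fun hh => hh.2 he)
      M B hM Finset.sdiff_disjoint (fun hh => h0 (hML hh)) (fun l hl => hB l (hML hl)) H
      (by
        intro a b
        rw [deleteEdges_adj]
        constructor
        · intro hab
          by_cases hh : s(a, b) ∈ p.edges
          · exact Or.inr hh
          · exact Or.inl ⟨hab, hh⟩
        · rintro (hh | hh)
          · exact hh.1
          · exact p.adj_of_mem_edges hh)
    refine ⟨g, by rwa [Finset.sdiff_union_of_subset hML] at hg, fun w => ?_⟩
    have h1 := hgs w
    have h2 := hfs w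
    split_ifs at h1 with hw
    · subst hw
      rw [hf.netSum_eq_zero hiso] at h1
      linarith
    · linarith

end SimpleGraph

/-! ### Sums of labelings, ranking, and extension of partial injections. -/

theorem netSum_add {V : Type*} [Fintype V] (f g : V → V → ℕ) (u : V) :
    netSum (fun a b => f a b + g a b) u = netSum f u + netSum g u := by
  simp only [netSum, ← Finset.sum_add_distrib]
  refine Finset.sum_congr rfl fun v _ => ?_
  push_cast
  ring

/-- An enumeration of `T` in the order of `w`. -/
theorem Finset.exists_bijOn_range_monotone {ι : Type*} (T : Finset ι) (w : ι → ℤ) :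
    ∃ r : ι → ℕ, Set.BijOn r T (Finset.range T.card) ∧
      ∀ x ∈ T, ∀ y ∈ T, r x < r y → w x ≤ w y := by
  classical
  induction T using Finset.induction_on_max_value w with
  | empty => exact ⟨fun _ => 0, by simp, by simp⟩
  | insert a s ha hmax ih =>
    obtain ⟨r, hr, hm⟩ := ih
    refine ⟨fun x => if x = a then s.card else r x, ?_, ?_⟩
    · rw [Finset.card_insert_of_notMem ha, Finset.range_add_one, Finset.coe_insert,
        Finset.coe_insert]
      have h1 : Set.BijOn (fun x => if x = a then s.card else r x) s (Finset.range s.card) := by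
        refine hr.congr fun x hx => ?_
        have : x ≠ a := fun hh => ha (hh ▸ hx)
        simp [this]
      have h2 := h1.insert (a := a) (by simp)
      simpa using h2
    · intro x hx y hy
      have hlt : ∀ z ∈ s, r z < s.card := fun z hz => by simpa using hr.mapsTo hz
      rw [Finset.mem_insert] at hx hy
      dsimp only
      rcases hx with rfl | hx <;> rcases hy with rfl | hy
      · simp
      · have : y ≠ x := fun hh => ha (hh ▸ hy)
        have := hlt y hy
        rw [if_pos rfl, if_neg ‹_›]
        intro
        omega
      · exact fun _ => hmax x hx
      · have h1 : x ≠ a := fun hh => ha (hh ▸ hx)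
        have h2 : y ≠ a := fun hh => ha (hh ▸ hy)
        simpa [h1, h2] using hm x hx y hy

/-- A partial injection into `{1, …, M}` extends. -/
theorem Finset.exists_injOn_extension {ι : Type*} {P K : Finset ι} (hPK : P ⊆ K) {M : ℕ}
    (hK : K.card ≤ M) {e : ι → ℕ} (he : Set.InjOn e P) (her : ∀ p ∈ P, 1 ≤ e p ∧ e p ≤ M) :
    ∃ e' : ι → ℕ, (∀ p ∈ P, e' p = e p) ∧ Set.InjOn e' K ∧ ∀ p ∈ K, 1 ≤ e' p ∧ e' p ≤ M := by
  classical
  induction hn : (K \ P).card generalizing P e with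
  | zero =>
    rw [Finset.card_eq_zero, Finset.sdiff_eq_empty_iff_subset] at hn
    have := hPK.antisymm hn
    subst this
    exact ⟨e, fun _ _ => rfl, he, her⟩
  | succ n ih =>
    obtain ⟨a, ha⟩ : (K \ P).Nonempty := by rw [← Finset.card_pos]; omega
    have ha' := Finset.mem_sdiff.mp ha
    have hlt : (P.image e).card < (Finset.Icc 1 M).card := by
      have h1 : P.card < K.card := Finset.card_lt_card ⟨hPK, fun h => ha'.2 (h ha'.1)⟩
      have h2 : (P.image e).card ≤ P.card := Finset.card_image_le
      simp only [Nat.card_Icc]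
      omega
    obtain ⟨l, hl, hlP⟩ := Finset.exists_mem_notMem_of_card_lt_card hlt
    have hne : ∀ p ∈ P, p ≠ a := fun p hp hh => ha'.2 (hh ▸ hp)
    have hnl : ∀ p ∈ P, e p ≠ l := fun p hp hh => hlP (hh ▸ Finset.mem_image_of_mem e hp)
    obtain ⟨e', h1, h2, h3⟩ := ih (P := insert a P) (e := fun p => if p = a then l else e p)
      (Finset.insert_subset ha'.1 hPK)
      (by
        intro x hx y hy hxy
        simp only [Finset.coe_insert, Set.mem_insert_iff, Finset.mem_coe] at hx hy
        have := @he x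
        grind)
      (by
        intro p hp
        rw [Finset.mem_insert] at hp
        rw [Finset.mem_Icc] at hl
        have := hne p
        have := her p
        grind)
      (by
        rw [Finset.sdiff_insert, Finset.card_erase_of_mem ha]
        omega)
    refine ⟨e', fun p hp => ?_, h2, h3⟩
    rw [h1 p (Finset.mem_insert_of_mem hp)]
    simp [hne p hp]

/-! ### Reducing to the sums on an independent dominating set. -/

namespace SimpleGraph

variable {V : Type*}

/-- The edges of `G` that avoid `S`. -/
def away (G : SimpleGraph V) (S : Finset V) : SimpleGraph V where
  Adj u v := G.Adj u v ∧ u ∉ S ∧ v ∉ S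
  symm := ⟨fun _ _ h => ⟨h.1.symm, h.2.2, h.2.1⟩⟩
  loopless := ⟨fun _ h => h.1.ne rfl⟩

open Classical in
/-- The edges between `S` and its complement, except for one edge `{φ t, t}` for each `t ∉ S`. -/
noncomputable def spare [Fintype V] (G : SimpleGraph V) (S : Finset V) (φ : V → V) :
    Finset (V × V) :=
  {p | p.1 ∈ S ∧ p.2 ∉ S ∧ G.Adj p.1 p.2 ∧ p.1 ≠ φ p.2}

theorem mem_spare [Fintype V] {G : SimpleGraph V} {S : Finset V} {φ : V → V} {p : V × V} :
    p ∈ G.spare S φ ↔ p.1 ∈ S ∧ p.2 ∉ S ∧ G.Adj p.1 p.2 ∧ p.1 ≠ φ p.2 := by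
  simp [spare]

/-- This count makes the label supply fit: the `m - k` labels below the reserved ones are exactly
enough for the spare edges and the edges avoiding `S`. -/
theorem ncard_edgeSet_eq [Fintype V] [DecidableEq V] {G : SimpleGraph V} {S : Finset V} (hS : G.IsIndepSet S)
    {φ : V → V} (hφ : ∀ t ∉ S, φ t ∈ S ∧ G.Adj (φ t) t) :
    G.edgeSet.ncard = (G.away S).edgeSet.ncard + (G.spare S φ).card + Sᶜ.card := by
  set A : Set (Sym2 V) := (fun p : V × V => s(p.1, p.2)) '' (G.spare S φ : Set (V × V))
  set C : Set (Sym2 V) := (fun t : V => s(φ t, t)) '' (Sᶜ : Finset V)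
  have hA : A.ncard = (G.spare S φ).card := by
    rw [Set.InjOn.ncard_image, Set.ncard_coe_finset]
    rintro ⟨a, b⟩ hab ⟨c, d⟩ hcd h
    simp only [Finset.mem_coe, mem_spare, Sym2.eq_iff] at hab hcd h
    grind
  have hC : C.ncard = Sᶜ.card := by
    rw [Set.InjOn.ncard_image, Set.ncard_coe_finset]
    intro a ha b hb h
    simp only [Finset.mem_coe, Finset.mem_compl, Sym2.eq_iff] at ha hb h
    have := hφ a ha
    have := hφ b hb
    grind
  have hE : G.edgeSet = ((G.away S).edgeSet ∪ A) ∪ C := by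
    ext e
    induction e using Sym2.ind with
    | _ x y =>
    simp only [mem_edgeSet, Set.mem_union, away, A, C, Set.mem_image, Finset.mem_coe, mem_spare,
      Finset.mem_compl, Prod.exists, Sym2.eq_iff]
    constructor
    · intro h
      by_cases hx : x ∈ S
      · have hy : y ∉ S := fun hy => hS hx hy h.ne h
        by_cases hh : x = φ y
        · exact Or.inr ⟨y, hy, Or.inl ⟨hh.symm, rfl⟩⟩
        · exact Or.inl (Or.inr ⟨x, y, ⟨hx, hy, h, hh⟩, Or.inl ⟨rfl, rfl⟩⟩)
      · by_cases hy : y ∈ S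
        · by_cases hh : y = φ x
          · exact Or.inr ⟨x, hx, Or.inr ⟨hh.symm, rfl⟩⟩
          · exact Or.inl (Or.inr ⟨y, x, ⟨hy, hx, h.symm, hh⟩, Or.inr ⟨rfl, rfl⟩⟩)
        · exact Or.inl (Or.inl ⟨h, hx, hy⟩)
    · rintro ((h | ⟨a, b, h, ⟨rfl, rfl⟩ | ⟨rfl, rfl⟩⟩) | ⟨t, ht, ⟨rfl, rfl⟩ | ⟨rfl, rfl⟩⟩)
      · exact h.1
      · exact h.2.2.1
      · exact h.2.2.1.symm
      · exact (hφ _ ht).2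
      · exact (hφ _ ht).2.symm
  have d1 : Disjoint (G.away S).edgeSet A := by
    rw [Set.disjoint_left]
    rintro _ h ⟨⟨a, b⟩, hab, rfl⟩
    rw [Finset.mem_coe, mem_spare] at hab
    exact h.2.1 hab.1
  have d2 : Disjoint ((G.away S).edgeSet ∪ A) C := by
    rw [Set.disjoint_left]
    rintro _ h ⟨t, ht, rfl⟩
    rw [Finset.mem_coe, Finset.mem_compl] at ht
    rcases h with h | ⟨⟨a, b⟩, hab, he⟩
    · exact h.2.1 (hφ t ht).1
    · rw [Finset.mem_coe, mem_spare] at hab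
      simp only [Sym2.eq_iff] at he
      have := hφ t ht
      grind
  rw [hE, Set.ncard_union_eq d2 (Set.toFinite _) (Set.toFinite _),
    Set.ncard_union_eq d1 (Set.toFinite _) (Set.toFinite _), hA, hC]

end SimpleGraph

namespace SimpleGraph

variable {V : Type*}

/-- A labeling of `G - S` and labels of the edges at the independent set `S`, all oriented out of
`S`, make up a labeling of `G`. -/
theorem IsLabeling.add_star_arcs [Fintype V] [DecidableEq V] {G : SimpleGraph V} {S : Finset V}
    (hS : G.IsIndepSet S) {L₀ L₁ L : Finset ℕ} {f g : V → V → ℕ} (hf : (G.away S).IsLabeling L₀ f)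
    (hg0 : ∀ s t, g s t ≠ 0 ↔ s ∈ S ∧ t ∉ S ∧ G.Adj s t)
    (hg : Set.BijOn (fun p : V × V => g p.1 p.2) {p | g p.1 p.2 ≠ 0} L₁)
    (hdisj : Disjoint L₀ L₁) (hL : L = L₀ ∪ L₁) :
    G.IsLabeling L fun u v => f u v + g u v := by
  have hfS : ∀ u v, f u v ≠ 0 → u ∉ S ∧ v ∉ S := fun u v h =>
    ((hf.adj_iff u v).2 (Or.inl h)).2
  have hzero : ∀ u v, f u v ≠ 0 → g u v = 0 := by
    intro u v h
    by_contra hh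
    exact (hfS u v h).1 ((hg0 u v).1 hh).1
  refine ⟨fun u v => ?_, fun u v => ?_, ?_⟩
  · have h1 := hf.adj_iff u v
    have h2 := hg0 u v
    have h3 := hg0 v u
    have h4 : u ∈ S → v ∈ S → ¬ G.Adj u v := fun hu hv h => hS hu hv h.ne h
    have h5 := G.adj_comm u v
    simp only [away] at h1
    simp only [ne_eq, Nat.add_eq_zero_iff]
    grind
  · have h1 := hf.asymm u v
    have h2 := hg0 u v
    have h3 := hg0 v u
    have h4 := hfS v u
    have h5 := hfS u v
    simp only [ne_eq, Nat.add_eq_zero_iff]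
    grind
  · have e : {p : V × V | f p.1 p.2 + g p.1 p.2 ≠ 0}
        = {p | f p.1 p.2 ≠ 0} ∪ {p | g p.1 p.2 ≠ 0} := by
      ext p
      simp only [Set.mem_union, Set.mem_ofPred_eq]
      omega
    have b1 : Set.BijOn (fun p : V × V => f p.1 p.2 + g p.1 p.2) {p | f p.1 p.2 ≠ 0} L₀ :=
      hf.bijOn.congr fun p hp => by simp [hzero p.1 p.2 hp]
    have b2 : Set.BijOn (fun p : V × V => f p.1 p.2 + g p.1 p.2) {p | g p.1 p.2 ≠ 0} L₁ := by
      refine hg.congr fun p hp => ?_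
      have : f p.1 p.2 = 0 := by
        by_contra hh
        exact hp (hzero p.1 p.2 hh)
      simp [this]
    rw [e, hL, Finset.coe_union]
    refine b1.union b2 ?_
    rw [Set.injOn_union]
    · refine ⟨b1.injOn, b2.injOn, fun a ha b hb hab => ?_⟩
      have m1 := b1.mapsTo ha
      have m2 := b2.mapsTo hb
      rw [hab] at m1
      exact Finset.disjoint_left.mp hdisj m1 m2
    · rw [Set.disjoint_left]
      exact fun p hp hq => hq (hzero p.1 p.2 hp)

/-- An independent dominating set `S` has labels `h` on its edges, extending `ex`, for which only the
sums at `S` remain to be separated, by permuting the labels at each vertex outside `S`. -/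
theorem exists_labels_of_dominating [Fintype V] [DecidableEq V] {G : SimpleGraph V} {S : Finset V}
    (hS : G.IsIndepSet S) {φ : V → V} (hφ : ∀ t ∉ S, φ t ∈ S ∧ G.Adj (φ t) t) {M : ℕ}
    (hM : M + Sᶜ.card = G.edgeSet.ncard) {P : Finset (V × V)} (hP : P ⊆ G.spare S φ)
    {ex : V × V → ℕ} (hex : Set.InjOn ex P) (hexM : ∀ p ∈ P, 1 ≤ ex p ∧ ex p ≤ M) :
    ∃ h : V → V → ℕ, (∀ p ∈ P, h p.1 p.2 = ex p) ∧
      (∀ t ∉ S, M < h (φ t) t ∧ h (φ t) t ≤ M + Sᶜ.card) ∧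
      (∀ t ∉ S, ∀ x ∈ S, ∀ y ∈ S, G.Adj x t → G.Adj y t → h x t = h y t → x = y) ∧
      ∀ σ : V → Equiv.Perm V,
        (∀ t ∉ S, ∀ s, (σ t s ∈ S ∧ G.Adj (σ t s) t) ↔ (s ∈ S ∧ G.Adj s t)) →
        Set.InjOn (fun s => ∑ t ∈ Sᶜ, (h (σ t s) t : ℤ)) S → G.HasAntimagicOrientation := by
  have hcount := ncard_edgeSet_eq hS hφ
  obtain ⟨ex', hex', hinj, hrange⟩ := Finset.exists_injOn_extension hP (M := M) (by omega) hex hexM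
  set K := G.spare S φ with hK
  set k := Sᶜ.card with hk
  set I := K.image ex' with hI
  have hIsub : I ⊆ Finset.Icc 1 M := by
    intro l hl
    obtain ⟨p, hp, rfl⟩ := Finset.mem_image.mp hl
    exact Finset.mem_Icc.mpr (hrange p hp)
  have hIcard : I.card = K.card := Finset.card_image_of_injOn hinj
  -- The small labels not spent on spare edges are all used here; as they are at most `M`, so is the
  -- loss at any vertex.
  obtain ⟨f, hf, hfs⟩ := exists_isLabeling_netSum_ge M _ (G.away S) (Finset.Icc 1 M \ I) rfl
    (by rw [Finset.card_sdiff_of_subset hIsub, hIcard, Nat.card_Icc]; omega)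
    (by simp) (fun l hl => (Finset.mem_Icc.mp (Finset.mem_sdiff.mp hl).1).2)
  set e : V → V → ℕ := fun s t => if (s, t) ∈ K then ex' (s, t) else 0 with he
  -- Ranking by the sum without the reserved edge: adding `M + 1 + r t` then gives strictly
  -- increasing sums, and `M + 1` outweighs the loss.
  obtain ⟨r, hr, hrm⟩ := Finset.exists_bijOn_range_monotone Sᶜ
    (fun t => netSum f t + ∑ s, (e s t : ℤ))
  set d : V → V → ℕ := fun s t => if t ∉ S ∧ s = φ t then M + 1 + r t else 0 with hd
  set h : V → V → ℕ := fun s t => e s t + d s t with hh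
  have hKmem : ∀ s t, (s, t) ∈ K ↔ s ∈ S ∧ t ∉ S ∧ G.Adj s t ∧ s ≠ φ t := fun s t => mem_spare
  have hK1 : ∀ s t, (s, t) ∈ K → h s t = ex' (s, t) := by
    intro s t hst
    have := (hKmem s t).1 hst
    simp [hh, he, hd, hst, this.2.2.2]
  have hF1 : ∀ t ∉ S, h (φ t) t = M + 1 + r t := by
    intro t ht
    have : (φ t, t) ∉ K := fun hh => ((hKmem _ _).1 hh).2.2.2 rfl
    simp [hh, he, hd, this, ht]
  have hrk : ∀ t ∉ S, r t < k := by
    intro t ht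
    have := hr.mapsTo (Finset.mem_coe.mpr (Finset.mem_compl.mpr ht))
    simpa using this
  have hh0 : ∀ s t, h s t ≠ 0 ↔ s ∈ S ∧ t ∉ S ∧ G.Adj s t := by
    intro s t
    constructor
    · intro hne
      by_cases h1 : (s, t) ∈ K
      · have := (hKmem s t).1 h1
        exact ⟨this.1, this.2.1, this.2.2.1⟩
      · have : d s t ≠ 0 := by
          intro h2
          apply hne
          simp [hh, he, h1, h2]
        simp only [hd] at this
        have h3 : t ∉ S ∧ s = φ t := by
          by_contra h4
          simp [h4] at this
        rw [h3.2]
        exact ⟨(hφ t h3.1).1, h3.1, (hφ t h3.1).2⟩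
    · rintro ⟨h1, h2, h3⟩
      by_cases h4 : s = φ t
      · rw [h4, hF1 t h2]; omega
      · have h5 : (s, t) ∈ K := (hKmem s t).2 ⟨h1, h2, h3, h4⟩
        rw [hK1 s t h5]
        have := hrange _ h5
        omega
  have hbij : Set.BijOn (fun p : V × V => h p.1 p.2) {p | h p.1 p.2 ≠ 0}
      ((I ∪ Finset.Icc (M + 1) (M + k) : Finset ℕ) : Set ℕ) := by
    have hset : {p : V × V | h p.1 p.2 ≠ 0}
        = (K : Set (V × V)) ∪ (fun t => (φ t, t)) '' (Sᶜ : Finset V) := by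
      ext ⟨s, t⟩
      simp only [Set.mem_ofPred_eq, hh0, Set.mem_union, Finset.mem_coe, hKmem, Set.mem_image,
        Finset.mem_compl, Prod.mk.injEq]
      constructor
      · rintro ⟨h1, h2, h3⟩
        by_cases h4 : s = φ t
        · exact Or.inr ⟨t, h2, h4.symm, rfl⟩
        · exact Or.inl ⟨h1, h2, h3, h4⟩
      · rintro (h1 | ⟨t', h1, rfl, rfl⟩)
        · exact ⟨h1.1, h1.2.1, h1.2.2.1⟩
        · exact ⟨(hφ _ h1).1, h1, (hφ _ h1).2⟩
    have b1 : Set.BijOn (fun p : V × V => h p.1 p.2) K I := by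
      have := hinj.bijOn_image
      rw [hI, Finset.coe_image]
      exact this.congr fun p hp => (hK1 p.1 p.2 hp).symm
    have b2 : Set.BijOn (fun p : V × V => h p.1 p.2) ((fun t => (φ t, t)) '' (Sᶜ : Finset V))
        (Finset.Icc (M + 1) (M + k) : Finset ℕ) := by
      refine ⟨?_, ?_, ?_⟩
      · rintro _ ⟨t, ht, rfl⟩
        have ht' : t ∉ S := Finset.mem_compl.mp ht
        simp only [Finset.mem_coe, Finset.mem_Icc, hF1 t ht']
        have := hrk t ht'
        omega
      · rintro _ ⟨t, ht, rfl⟩ _ ⟨t', ht', rfl⟩ heq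
        have h1 : t ∉ S := Finset.mem_compl.mp ht
        have h2 : t' ∉ S := Finset.mem_compl.mp ht'
        simp only [hF1 t h1, hF1 t' h2] at heq
        have := hr.injOn ht ht' (by omega)
        rw [this]
      · intro l hl
        simp only [Finset.mem_coe, Finset.mem_Icc] at hl
        obtain ⟨t, ht, htl⟩ := hr.surjOn (show l - (M + 1) ∈ ((Finset.range k : Finset ℕ) : Set ℕ) by
          simp only [Finset.coe_range, Set.mem_Iio]; omega)
        refine ⟨(φ t, t), ⟨t, ht, rfl⟩, ?_⟩
        simp only [hF1 t (Finset.mem_compl.mp ht), htl]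
        omega
    rw [hset, Finset.coe_union]
    refine b1.union b2 ?_
    rw [Set.injOn_union]
    · refine ⟨b1.injOn, b2.injOn, fun a ha b hb hab => ?_⟩
      have m1 := Finset.mem_Icc.mp (hIsub (b1.mapsTo ha))
      have m2 := Finset.mem_Icc.mp (b2.mapsTo hb)
      omega
    · rw [Set.disjoint_left]
      rintro _ hp ⟨t, _, rfl⟩
      exact ((hKmem _ _).1 hp).2.2.2 rfl
  refine ⟨h, ?_, ?_, ?_, ?_⟩
  · intro p hp
    rw [hK1 p.1 p.2 (hP hp), ← hex' p hp]
  · intro t ht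
    rw [hF1 t ht]
    have := hrk t ht
    omega
  · intro t ht x hx y hy hxt hyt hxy
    have := hbij.injOn (x₁ := (x, t)) (x₂ := (y, t)) ((hh0 x t).2 ⟨hx, ht, hxt⟩)
      ((hh0 y t).2 ⟨hy, ht, hyt⟩) hxy
    exact congrArg Prod.fst this
  · intro σ hσ hσinj
    have hg0 : ∀ s t, (fun s t => h (σ t s) t) s t ≠ 0 ↔ s ∈ S ∧ t ∉ S ∧ G.Adj s t := by
      intro s t
      simp only [hh0]
      by_cases ht : t ∈ S
      · simp [ht]
      · have := hσ t ht s
        tauto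
    have hg : Set.BijOn (fun p : V × V => (fun s t => h (σ t s) t) p.1 p.2)
        {p | (fun s t => h (σ t s) t) p.1 p.2 ≠ 0}
        ((I ∪ Finset.Icc (M + 1) (M + k) : Finset ℕ) : Set ℕ) := by
      refine hbij.comp (f := fun p : V × V => (σ p.2 p.1, p.2)) ⟨fun p hp => hp, ?_, ?_⟩
      · rintro ⟨a, b⟩ _ ⟨c, d⟩ _ heq
        simp only [Prod.mk.injEq] at heq
        obtain ⟨h1, rfl⟩ := heq
        rw [(σ b).injective h1]
      · rintro ⟨a, b⟩ hab
        exact ⟨((σ b).symm a, b), by simpa using hab, by simp⟩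
    have hlab : G.IsLabeling (Finset.Icc 1 (M + k)) fun u v => f u v + h (σ v u) v := by
      refine hf.add_star_arcs hS hg0 hg ?_ ?_
      · rw [Finset.disjoint_left]
        intro l hl
        simp only [Finset.mem_sdiff, Finset.mem_Icc, Finset.mem_union] at hl ⊢
        rintro (h1 | h1)
        · exact hl.2 h1
        · omega
      · rw [← Finset.union_assoc, Finset.sdiff_union_of_subset hIsub]
        ext l
        simp only [Finset.mem_Icc, Finset.mem_union]
        omega
    have hsS : ∀ s ∈ S, netSum (fun u v => f u v + h (σ v u) v) s
        = - ∑ t ∈ Sᶜ, (h (σ t s) t : ℤ) := by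
      intro s hs
      rw [netSum_add f (fun u v => h (σ v u) v), hf.netSum_eq_zero fun v hv => hv.2.1 hs, zero_add,
        netSum, Finset.sum_sub_distrib]
      have h1 : ∑ v, (h (σ s v) s : ℤ) = 0 := by
        refine Finset.sum_eq_zero fun v _ => ?_
        have := hg0 v s
        simp only [hs, not_true_eq_false, false_and, and_false, iff_false, not_not] at this
        exact_mod_cast this
      have h2 : ∑ v, (h (σ v s) v : ℤ) = ∑ t ∈ Sᶜ, (h (σ t s) t : ℤ) := by
        symm
        refine Finset.sum_subset (Finset.subset_univ _) fun t _ ht => ?_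
        have hts : t ∈ S := by simpa using ht
        have := hg0 s t
        simp only [hts, not_true_eq_false, false_and, and_false, iff_false, not_not] at this
        exact_mod_cast this
      rw [h1, h2, zero_sub]
    have hsT : ∀ t ∉ S, netSum (fun u v => f u v + h (σ v u) v) t
        = netSum f t + ∑ s, (e s t : ℤ) + (M + 1 + r t) := by
      intro t ht
      rw [netSum_add f (fun u v => h (σ v u) v), add_assoc]
      congr 1
      rw [netSum, Finset.sum_sub_distrib]
      have h1 : ∑ v, (h (σ v t) v : ℤ) = 0 := by
        refine Finset.sum_eq_zero fun v _ => ?_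
        have := hg0 t v
        simp only [ht, false_and, iff_false, not_not] at this
        exact_mod_cast this
      -- The permutation only reorders the labels entering `t`, which is why it is free outside `S`.
      have h2 : ∑ v, (h (σ t v) t : ℤ) = ∑ v, (h v t : ℤ) :=
        Equiv.sum_comp (σ t) fun v => (h v t : ℤ)
      rw [h1, h2, sub_zero]
      simp only [hh, hd, Nat.cast_add, Finset.sum_add_distrib]
      congr 1
      simp [ht]
    have hpos : ∀ t ∉ S, 0 < netSum (fun u v => f u v + h (σ v u) v) t := by
      intro t ht
      rw [hsT t ht]
      have h1 := hfs t
      have h2 : (0 : ℤ) ≤ ∑ s, (e s t : ℤ) := Finset.sum_nonneg fun s _ => by positivity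
      omega
    have hneg : ∀ s ∈ S, netSum (fun u v => f u v + h (σ v u) v) s ≤ 0 := by
      intro s hs
      rw [hsS s hs]
      have h2 : (0 : ℤ) ≤ ∑ t ∈ Sᶜ, (h (σ t s) t : ℤ) := Finset.sum_nonneg fun s _ => by positivity
      omega
    refine hlab.hasAntimagicOrientation fun u v huv => ?_
    by_cases hu : u ∈ S <;> by_cases hv : v ∈ S
    · rw [hsS u hu, hsS v hv, neg_inj] at huv
      exact hσinj hu hv huv
    · have := hneg u hu
      have := hpos v hv
      omega
    · have := hneg v hv
      have := hpos u hu
      omega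
    · rw [hsT u hu, hsT v hv] at huv
      have hu' := Finset.mem_compl.mpr hu
      have hv' := Finset.mem_compl.mpr hv
      rcases lt_trichotomy (r u) (r v) with hlt | heq | hlt
      · have := hrm u hu' v hv' hlt
        omega
      · exact hr.injOn (Finset.mem_coe.mpr hu') (Finset.mem_coe.mpr hv') heq
      · have := hrm v hv' u hu' hlt
        omega

end SimpleGraph

/-! ### Separating the sums on at most three vertices. -/

/-- Permuting the values of `k` on `S` makes `R + k` injective on `S`. -/
theorem Finset.exists_perm_add_injOn {V : Type*} [DecidableEq V] (S : Finset V) (R : V → ℤ) :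
    ∀ k : V → ℤ, Set.InjOn k S → ∃ σ : Equiv.Perm V, (∀ s, s ∉ S → σ s = s) ∧
      Set.InjOn (fun s => R s + k (σ s)) S := by
  induction S using Finset.induction_on_max_value R with
  | empty => exact fun _ _ => ⟨1, by simp, by simp⟩
  | insert a S ha hmax ih =>
    intro k hk
    -- Pairing the largest `k` with the largest `R`, and so on downwards, makes the sums strictly
    -- increasing.
    obtain ⟨m, hm, hmk⟩ := (insert a S).exists_max_image k (Finset.insert_nonempty a S)
    have hmaps : ∀ s ∈ insert a S, Equiv.swap a m s ∈ insert a S := by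
      intro s hs
      rw [Equiv.swap_apply_def]
      split_ifs <;> simp_all
    obtain ⟨σ, hσ, hinj⟩ := ih (fun s => k (Equiv.swap a m s)) (by
      intro x hx y hy hxy
      exact (Equiv.swap a m).injective (hk (hmaps x (Finset.mem_insert_of_mem hx))
        (hmaps y (Finset.mem_insert_of_mem hy)) hxy))
    have hσS : ∀ s ∈ S, σ s ∈ S := by
      intro s hs
      by_contra hh
      have h2 : σ s = s := σ.injective (hσ _ hh)
      exact hh (h2.symm ▸ hs)
    refine ⟨σ.trans (Equiv.swap a m), fun s hs => ?_, ?_⟩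
    · have h1 : s ∉ S := fun hh => hs (Finset.mem_insert_of_mem hh)
      have h2 : s ≠ a := fun hh => hs (hh ▸ Finset.mem_insert_self _ _)
      have h3 : s ≠ m := fun hh => hs (hh ▸ hm)
      rw [Equiv.trans_apply, hσ s h1, Equiv.swap_apply_of_ne_of_ne h2 h3]
    · have hval : k (Equiv.swap a m (σ a)) = k m := by rw [hσ a ha, Equiv.swap_apply_left]
      have hlt : ∀ s ∈ S, k (Equiv.swap a m (σ s)) < k m := by
        intro s hs
        refine lt_of_le_of_ne (hmk _ (hmaps _ (Finset.mem_insert_of_mem (hσS s hs)))) fun hh => ?_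
        have h1 := hk (hmaps _ (Finset.mem_insert_of_mem (hσS s hs))) hm hh
        have h2 : σ s = a := by
          have := congrArg (Equiv.swap a m) h1
          rwa [Equiv.swap_apply_self, Equiv.swap_apply_right] at this
        exact ha (h2 ▸ hσS s hs)
      rw [Finset.coe_insert, Set.injOn_insert (by simpa using ha)]
      refine ⟨hinj, ?_⟩
      rintro ⟨s, hs, heq⟩
      have h1 := hlt s hs
      have h2 := hmax s hs
      simp only [Equiv.trans_apply, hval] at heq
      omega

namespace SimpleGraph

variable {V : Type*}

/-- An independent dominating set `S` has labels `h` on its edges for which only the sums at `S`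
remain to be separated, by permuting the labels at each vertex of a set `C`. -/
theorem exists_labels_of_dominating_of_perm [Fintype V] [DecidableEq V] {G : SimpleGraph V} {S : Finset V}
    (hS : G.IsIndepSet S) (hdom : ∀ t ∉ S, ∃ s ∈ S, G.Adj s t) {C : Finset V} {ψ : V → V}
    (hC : ∀ c ∈ C, c ∉ S ∧ ψ c ∈ S ∧ G.Adj (ψ c) c) {P : Finset (V × V)}
    (hP : ∀ p ∈ P, p.2 ∈ C ∧ p.1 ∈ S ∧ G.Adj p.1 p.2 ∧ p.1 ≠ ψ p.2) {ex : V × V → ℕ}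
    (hex : Set.InjOn ex P) (hexM : ∀ p ∈ P, 1 ≤ ex p ∧ ex p + Sᶜ.card ≤ G.edgeSet.ncard) :
    ∃ (h : V → V → ℕ) (R : V → ℤ), (∀ p ∈ P, h p.1 p.2 = ex p) ∧
      (∀ c ∈ C, G.edgeSet.ncard < h (ψ c) c + Sᶜ.card ∧ h (ψ c) c ≤ G.edgeSet.ncard) ∧
      (∀ c ∈ C, ∀ x ∈ S, ∀ y ∈ S, G.Adj x c → G.Adj y c → h x c = h y c → x = y) ∧
      ∀ σ : V → Equiv.Perm V,
        (∀ c ∈ C, ∀ s, (σ c s ∈ S ∧ G.Adj (σ c s) c) ↔ (s ∈ S ∧ G.Adj s c)) →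
        Set.InjOn (fun s => R s + ∑ c ∈ C, (h (σ c s) c : ℤ)) S → G.HasAntimagicOrientation := by
  choose! φ₀ hφ₀ using hdom
  -- On `C` the reserved edge is the one chosen by `ψ`, so its label is known to be large.
  set φ : V → V := fun t => if t ∈ C then ψ t else φ₀ t with hφdef
  have hφ : ∀ t ∉ S, φ t ∈ S ∧ G.Adj (φ t) t := by
    intro t ht
    by_cases htC : t ∈ C
    · simpa [hφdef, htC] using (hC t htC).2
    · simpa [hφdef, htC] using hφ₀ t ht
  have hφC : ∀ c ∈ C, φ c = ψ c := fun c hc => by simp [hφdef, hc]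
  have hle := ncard_edgeSet_eq hS hφ
  obtain ⟨h, h1, h2, h3, h4⟩ := exists_labels_of_dominating hS hφ
    (M := G.edgeSet.ncard - Sᶜ.card) (by omega) (P := P)
    (by
      intro p hp
      obtain ⟨a, b, c, d⟩ := hP p hp
      exact mem_spare.2 ⟨b, (hC _ a).1, c, by rwa [hφC _ a]⟩) hex
    (fun p hp => by have := hexM p hp; omega)
  -- The contributions of vertices outside `C` are never permuted and are collected in `R`.
  refine ⟨h, fun s => ∑ t ∈ Sᶜ \ C, (h s t : ℤ), h1, fun c hc => ?_, fun c hc => h3 c (hC c hc).1,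
    fun σ hσ hinj => ?_⟩
  · have := h2 c (hC c hc).1
    rw [hφC c hc] at this
    omega
  · refine h4 (fun t => if t ∈ C then σ t else 1) (fun t _ s => ?_) ?_
    · by_cases htC : t ∈ C
      · simpa only [htC, if_true] using hσ t htC s
      · simp [htC]
    · convert hinj using 2 with s
      have hsub : C ⊆ Sᶜ := fun c hc => Finset.mem_compl.mpr (hC c hc).1
      rw [← Finset.sum_sdiff hsub]
      congr 1
      · refine Finset.sum_congr rfl fun t ht => ?_
        simp [(Finset.mem_sdiff.mp ht).2]
      · refine Finset.sum_congr rfl fun t ht => ?_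
        simp [ht]

theorem _root_.Finset.injOn_three {ι α : Type*} [DecidableEq ι] {f : ι → α} {x y z : ι}
    (hxy : f x ≠ f y) (hxz : f x ≠ f z) (hyz : f y ≠ f z) :
    Set.InjOn f ({x, y, z} : Finset ι) := by
  intro a ha b hb hab
  simp only [Finset.coe_insert, Finset.coe_singleton, Set.mem_insert_iff,
    Set.mem_singleton_iff] at ha hb
  rcases ha with rfl | rfl | rfl <;> rcases hb with rfl | rfl | rfl <;> simp_all

theorem swap_mem_iff [DecidableEq V] {p : V → Prop} {x y : V} (h : p x ↔ p y) (s : V) :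
    p (Equiv.swap x y s) ↔ p s := by
  rw [Equiv.swap_apply_def]
  split_ifs with h1 h2
  · rw [h1, h]
  · rw [h2, h]
  · rfl

theorem hasAntimagicOrientation_of_dominating_singleton [Fintype V] {G : SimpleGraph V} {v : V}
    (hdom : ∀ t, t ≠ v → G.Adj v t) : G.HasAntimagicOrientation := by
  classical
  obtain ⟨h, R, -, -, -, h4⟩ := exists_labels_of_dominating_of_perm (G := G) (S := {v}) (by simp)
    (fun t ht => ⟨v, by simp, hdom t (by simpa using ht)⟩) (C := ∅) (ψ := id) (by simp) (P := ∅)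
    (by simp) (ex := fun _ => 0) (by simp) (by simp)
  exact h4 (fun _ => 1) (by simp) (by simp)

/-- The labels at `c` are distinct and may be permuted arbitrarily over `S`, so sorting them along
the remaining sums separates `S`. -/
theorem hasAntimagicOrientation_of_common_adj [Fintype V] {G : SimpleGraph V} {S : Finset V}
    (hne : S.Nonempty) (hS : G.IsIndepSet S) (hdom : ∀ t ∉ S, ∃ s ∈ S, G.Adj s t) {c : V}
    (hc : ∀ s ∈ S, G.Adj s c) : G.HasAntimagicOrientation := by
  classical
  obtain ⟨x, hx⟩ := hne
  have hcS : c ∉ S := fun h => (hc c h).ne rfl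
  obtain ⟨h, R, -, -, h3, h4⟩ := exists_labels_of_dominating_of_perm hS
    hdom (C := {c}) (ψ := fun _ => x) (by simpa using ⟨hcS, hx, hc x hx⟩) (P := ∅)
    (by simp) (ex := fun _ => 0) (by simp) (by simp)
  obtain ⟨σ, hσ, hinj⟩ := S.exists_perm_add_injOn R (fun s => (h s c : ℤ)) (by
    intro a ha b hb hab
    exact h3 c (by simp) a ha b hb (hc a ha) (hc b hb) (Nat.cast_injective hab))
  have hmem : ∀ s, σ s ∈ S ↔ s ∈ S := by
    intro s
    constructor
    · intro hs
      by_contra hh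
      rw [hσ s hh] at hs
      exact hh hs
    · intro hs
      by_contra hh
      have h2 : σ s = s := σ.injective (hσ _ hh)
      exact hh (h2.symm ▸ hs)
  refine h4 (fun _ => σ) (fun a ha s => ?_) (by simpa using hinj)
  rw [Finset.mem_singleton] at ha
  subst ha
  constructor
  · rintro ⟨h1, -⟩
    exact ⟨(hmem s).1 h1, hc s ((hmem s).1 h1)⟩
  · rintro ⟨h1, -⟩
    exact ⟨(hmem s).2 h1, hc _ ((hmem s).2 h1)⟩

/-- Three independent vertices `x, y, z` that dominate `G`, with common neighbors of `x, y` and of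
`y, z`. -/
theorem hasAntimagicOrientation_of_dominating_three [Fintype V] [DecidableEq V] {G : SimpleGraph V}
    {x y z : V}
    (hxy : x ≠ y) (hxz : x ≠ z) (hyz : y ≠ z) (hS : G.IsIndepSet ({x, y, z} : Finset V))
    (hdom : ∀ t ∉ ({x, y, z} : Finset V), ∃ s ∈ ({x, y, z} : Finset V), G.Adj s t)
    (h1 : ∃ c, G.Adj x c ∧ G.Adj y c) (h2 : ∃ c, G.Adj y c ∧ G.Adj z c)
    (hm : 2 * ({x, y, z} : Finset V)ᶜ.card < G.edgeSet.ncard) : G.HasAntimagicOrientation := by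
  obtain ⟨c, hcx, hcy⟩ := h1
  obtain ⟨d, hdy, hdz⟩ := h2
  by_cases hcz : G.Adj z c
  · exact hasAntimagicOrientation_of_common_adj (by simp) hS hdom (c := c) (by simp [*])
  have hcd : c ≠ d := fun h => hcz (h ▸ hdz)
  have hout : ∀ c, ∀ s ∈ ({x, y, z} : Finset V), G.Adj s c → c ∉ ({x, y, z} : Finset V) :=
    fun c s hs hsc hc => hS hs hc hsc.ne hsc
  set k := ({x, y, z} : Finset V)ᶜ.card with hk
  obtain ⟨h, R, hP, hF, -, hAO⟩ := exists_labels_of_dominating_of_perm hS hdom (C := {c, d})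
    (ψ := fun t => if t = c then y else z)
    (by
      simp only [Finset.mem_insert, Finset.mem_singleton, forall_eq_or_imp, forall_eq, if_true,
        if_neg hcd.symm]
      exact ⟨⟨by simpa using hout c x (by simp) hcx, by simp, hcy⟩,
        ⟨by simpa using hout d y (by simp) hdy, by simp, hdz⟩⟩)
    (P := {(x, c), (y, d)}) (by simp [*, hcd.symm])
    -- With these labels a swap at `c` moves some `p ≥ m - k` from `y` to `x`, and a swap at `d`
    -- moves some `q` with `1 ≤ q ≤ k < m - k` from `z` to `y`.
    (ex := fun p => if p.2 = c then 1 else G.edgeSet.ncard - k)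
    (by
      have : G.edgeSet.ncard - k ≠ 1 := by
        have : 0 < k := Finset.card_pos.mpr ⟨c, by simpa using hout c x (by simp) hcx⟩
        omega
      simp [Set.InjOn, hcd.symm, this, this.symm])
    (by
      simp only [Finset.mem_insert, Finset.mem_singleton, forall_eq_or_imp, forall_eq, if_true,
        if_neg hcd.symm]
      omega)
  have e1 := hP (x, c) (by simp)
  have e2 := hP (y, d) (by simp)
  have e3 := hF c (by simp)
  have e4 := hF d (by simp)
  simp only [if_true, if_neg hcd.symm] at e1 e2 e3 e4
  by_contra hno
  -- A coincidence rules out at most one of the four choices, except that the sums at `y` and `z`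
  -- can agree twice if `p = 2q`; the other two choices then cannot both fail.
  have key : ∀ e f : Bool, R x + (if e then h y c else h x c) + h x d
        = R y + (if e then h x c else h y c) + (if f then h z d else h y d) ∨
      R x + (if e then h y c else h x c) + h x d = R z + h z c + (if f then h y d else h z d) ∨
      R y + (if e then h x c else h y c) + (if f then h z d else h y d)
        = R z + h z c + (if f then h y d else h z d) := by
    intro e f
    by_contra hk
    push Not at hk
    refine hno (hAO (fun t => if t = c then (if e then Equiv.swap x y else 1)
      else (if f then Equiv.swap y z else 1)) ?_ ?_)
    · simp only [Finset.mem_insert, Finset.mem_singleton, forall_eq_or_imp, forall_eq, if_true,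
        if_neg hcd.symm]
      refine ⟨fun s => ?_, fun s => ?_⟩
      · cases e
        · simp
        · exact swap_mem_iff (p := fun s => (s = x ∨ s = y ∨ s = z) ∧ G.Adj s c) (by simp [*]) s
      · cases f
        · simp
        · exact swap_mem_iff (p := fun s => (s = x ∨ s = y ∨ s = z) ∧ G.Adj s d) (by simp [*]) s
    · refine Finset.injOn_three ?_ ?_ ?_ <;> cases e <;> cases f <;>
        simp [Finset.sum_pair hcd, hcd.symm, Equiv.swap_apply_of_ne_of_ne, hxy, hxz,
          hxz.symm, hyz.symm] at hk ⊢ <;> omega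
  have k1 := key false false
  have k2 := key false true
  have k3 := key true false
  have k4 := key true true
  simp only [if_true, Bool.false_eq_true, if_false] at k1 k2 k3 k4
  omega

end SimpleGraph

/-! ### Separating the sums on four vertices. -/

/-- The change at `s` when `p` is moved from `v` to `u`. -/
def transfer {V : Type*} [DecidableEq V] (e : Bool) (p : ℤ) (u v s : V) : ℤ :=
  if e then (if s = u then p else if s = v then -p else 0) else 0

theorem Finset.injOn_four {ι α : Type*} [DecidableEq ι] {f : ι → α} {x y z w : ι}
    (hxy : f x ≠ f y) (hxz : f x ≠ f z) (hxw : f x ≠ f w) (hyz : f y ≠ f z) (hyw : f y ≠ f w)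
    (hzw : f z ≠ f w) : Set.InjOn f ({x, y, z, w} : Finset ι) := by
  intro a ha b hb hab
  simp only [Finset.coe_insert, Finset.coe_singleton, Set.mem_insert_iff,
    Set.mem_singleton_iff] at ha hb
  rcases ha with rfl | rfl | rfl | rfl <;> rcases hb with rfl | rfl | rfl | rfl <;> simp_all

namespace SimpleGraph

variable {V : Type*}

/-- Three vertices outside `S`, each with two neighbors in `S`, allow three independent transfers
between the sums at `S`, of very different sizes. -/
theorem exists_three_transfers [Fintype V] [DecidableEq V] {G : SimpleGraph V} {S : Finset V}
    (hS : G.IsIndepSet S) (hdom : ∀ t ∉ S, ∃ s ∈ S, G.Adj s t)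
    (hm : 4 * Sᶜ.card < G.edgeSet.ncard) {u₁ v₁ u₂ v₂ u₃ v₃ c₁ c₂ c₃ : V}
    (hu₁ : u₁ ∈ S) (hv₁ : v₁ ∈ S) (hu₂ : u₂ ∈ S) (hv₂ : v₂ ∈ S) (hu₃ : u₃ ∈ S) (hv₃ : v₃ ∈ S)
    (h₁ : u₁ ≠ v₁) (h₂ : u₂ ≠ v₂) (h₃ : u₃ ≠ v₃)
    (a₁ : G.Adj u₁ c₁) (b₁ : G.Adj v₁ c₁) (a₂ : G.Adj u₂ c₂) (b₂ : G.Adj v₂ c₂)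
    (a₃ : G.Adj u₃ c₃) (b₃ : G.Adj v₃ c₃) (h₁₂ : c₁ ≠ c₂) (h₁₃ : c₁ ≠ c₃) (h₂₃ : c₂ ≠ c₃) :
    ∃ (B : V → ℤ) (p q r : ℤ), 0 < r ∧ r < q ∧ q + r < p ∧ 3 * r < p ∧ ∀ e f g : Bool,
      Set.InjOn (fun s => B s + transfer e p u₁ v₁ s + transfer f q u₂ v₂ s
        + transfer g r u₃ v₃ s) S → G.HasAntimagicOrientation := by
  have hout : ∀ c, ∀ s ∈ S, G.Adj s c → c ∉ S := fun c s hs hsc hc => hS hs hc hsc.ne hsc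
  set k := Sᶜ.card with hk
  have hk0 : 0 < k := Finset.card_pos.mpr ⟨c₁, by simpa using hout c₁ u₁ hu₁ a₁⟩
  obtain ⟨h, R, hP, hF, -, hAO⟩ := exists_labels_of_dominating_of_perm hS hdom
    (C := {c₁, c₂, c₃}) (ψ := fun t => if t = c₁ then v₁ else if t = c₂ then v₂ else v₃)
    (by
      simp only [Finset.mem_insert, Finset.mem_singleton, forall_eq_or_imp, forall_eq, if_true,
        if_neg h₁₂.symm, if_neg h₁₃.symm, if_neg h₂₃.symm]
      exact ⟨⟨hout _ _ hu₁ a₁, hv₁, b₁⟩, ⟨hout _ _ hu₂ a₂, hv₂, b₂⟩, ⟨hout _ _ hu₃ a₃, hv₃, b₃⟩⟩)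
    (P := {(u₁, c₁), (u₂, c₂), (u₃, c₃)}) (by simp [*, h₁₂.symm, h₁₃.symm, h₂₃.symm])
    -- The partners of these labels lie in `(m - k, m]`, so `p ≥ m - k`, `k < q ≤ 2k` and `1 ≤ r ≤
    -- k`. Now `4k < m` gives `q + r ≤ 3k < p`.
    (ex := fun p => if p.2 = c₁ then 1 else if p.2 = c₂ then G.edgeSet.ncard - 2 * k
      else G.edgeSet.ncard - k)
    (by
      apply Finset.injOn_three <;>
        simp only [if_true, if_neg h₁₂.symm, if_neg h₁₃.symm, if_neg h₂₃.symm] <;> omega)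
    (by
      simp only [Finset.mem_insert, Finset.mem_singleton, forall_eq_or_imp, forall_eq, if_true,
        if_neg h₁₂.symm, if_neg h₁₃.symm, if_neg h₂₃.symm]
      omega)
  have e1 := hP (u₁, c₁) (by simp)
  have e2 := hP (u₂, c₂) (by simp)
  have e3 := hP (u₃, c₃) (by simp)
  have f1 := hF c₁ (by simp)
  have f2 := hF c₂ (by simp)
  have f3 := hF c₃ (by simp)
  simp only [if_true, if_neg h₁₂.symm, if_neg h₁₃.symm, if_neg h₂₃.symm] at e1 e2 e3 f1 f2 f3
  refine ⟨fun s => R s + h s c₁ + h s c₂ + h s c₃, (h v₁ c₁ : ℤ) - h u₁ c₁, (h v₂ c₂ : ℤ) - h u₂ c₂,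
    (h v₃ c₃ : ℤ) - h u₃ c₃, by omega, by omega, by omega, by omega, fun e f g hinj => ?_⟩
  have hswap : ∀ (e : Bool) (c u v : V), u ∈ S → v ∈ S → G.Adj u c → G.Adj v c → ∀ s,
      ((if e then Equiv.swap u v else 1) s ∈ S ∧ G.Adj ((if e then Equiv.swap u v else 1) s) c) ↔
        (s ∈ S ∧ G.Adj s c) := by
    intro e c u v hu hv hac hbc s
    cases e
    · simp
    · exact swap_mem_iff (p := fun s => s ∈ S ∧ G.Adj s c) (by simp [*]) s
  have hval : ∀ (e : Bool) (c u v : V), u ≠ v → ∀ s,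
      (h ((if e then Equiv.swap u v else 1) s) c : ℤ)
        = h s c + transfer e ((h v c : ℤ) - h u c) u v s := by
    intro e c u v huv s
    cases e
    · simp [transfer]
    · simp only [if_true, transfer, Equiv.swap_apply_def]
      split_ifs with h1 h2
      · subst h1; ring
      · subst h2; ring
      · ring
  refine hAO (fun t => if t = c₁ then (if e then Equiv.swap u₁ v₁ else 1)
      else if t = c₂ then (if f then Equiv.swap u₂ v₂ else 1)
      else (if g then Equiv.swap u₃ v₃ else 1)) ?_ ?_
  · simp only [Finset.mem_insert, Finset.mem_singleton, forall_eq_or_imp, forall_eq, if_true,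
      if_neg h₁₂.symm, if_neg h₁₃.symm, if_neg h₂₃.symm]
    exact ⟨hswap e c₁ u₁ v₁ hu₁ hv₁ a₁ b₁, hswap f c₂ u₂ v₂ hu₂ hv₂ a₂ b₂,
      hswap g c₃ u₃ v₃ hu₃ hv₃ a₃ b₃⟩
  · convert hinj using 2 with s
    rw [Finset.sum_insert (by simp [h₁₂, h₁₃]), Finset.sum_pair h₂₃]
    simp only [if_true, if_neg h₁₂.symm, if_neg h₁₃.symm, if_neg h₂₃.symm]
    rw [hval e c₁ u₁ v₁ h₁, hval f c₂ u₂ v₂ h₂, hval g c₃ u₃ v₃ h₃]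
    ring

-- Each equality prescribes a small combination of `e * p`, `f * q` and `g * r`, so it holds for few
-- of the eight choices, but counting alone leaves exceptional cases. Splitting on the equalities at
-- `(0, 0, 0)` and `(1, 1, 1)` leaves linear problems.
set_option maxHeartbeats 4000000 in
theorem not_forall_transfer_path (a b c d p q r : ℤ) (h1 : 0 < r) (h2 : r < q) (h3 : q + r < p)
    (h4 : 3 * r < p)
    (H : ∀ e f g : ℤ, (e = 0 ∨ e = 1) → (f = 0 ∨ f = 1) → (g = 0 ∨ g = 1) →
      a + e * p = b - e * p + f * q ∨ a + e * p = c - f * q + g * r ∨ a + e * p = d - g * r ∨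
      b - e * p + f * q = c - f * q + g * r ∨ b - e * p + f * q = d - g * r ∨
      c - f * q + g * r = d - g * r) : False := by
  have H1 := H 0 0 0 (by simp) (by simp) (by simp)
  have H2 := H 0 0 1 (by simp) (by simp) (by simp)
  have H3 := H 0 1 0 (by simp) (by simp) (by simp)
  have H4 := H 0 1 1 (by simp) (by simp) (by simp)
  have H5 := H 1 0 0 (by simp) (by simp) (by simp)
  have H6 := H 1 0 1 (by simp) (by simp) (by simp)
  have H7 := H 1 1 0 (by simp) (by simp) (by simp)
  have H8 := H 1 1 1 (by simp) (by simp) (by simp)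
  clear H
  simp only [zero_mul, one_mul] at *
  rcases H1 with H1 | H1 | H1 | H1 | H1 | H1 <;> rcases H8 with H8 | H8 | H8 | H8 | H8 | H8 <;> omega

set_option maxHeartbeats 4000000 in
theorem not_forall_transfer_star (a b c d p q r : ℤ) (h1 : 0 < r) (h2 : r < q) (h3 : q + r < p)
    (h4 : 3 * r < p)
    (H : ∀ e f g : ℤ, (e = 0 ∨ e = 1) → (f = 0 ∨ f = 1) → (g = 0 ∨ g = 1) →
      a + e * p + f * q + g * r = b - e * p ∨ a + e * p + f * q + g * r = c - f * q ∨
      a + e * p + f * q + g * r = d - g * r ∨ b - e * p = c - f * q ∨ b - e * p = d - g * r ∨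
      c - f * q = d - g * r) : False := by
  have H1 := H 0 0 0 (by simp) (by simp) (by simp)
  have H2 := H 0 0 1 (by simp) (by simp) (by simp)
  have H3 := H 0 1 0 (by simp) (by simp) (by simp)
  have H4 := H 0 1 1 (by simp) (by simp) (by simp)
  have H5 := H 1 0 0 (by simp) (by simp) (by simp)
  have H6 := H 1 0 1 (by simp) (by simp) (by simp)
  have H7 := H 1 1 0 (by simp) (by simp) (by simp)
  have H8 := H 1 1 1 (by simp) (by simp) (by simp)
  clear H
  simp only [zero_mul, one_mul] at *
  rcases H1 with H1 | H1 | H1 | H1 | H1 | H1 <;> rcases H8 with H8 | H8 | H8 | H8 | H8 | H8 <;> omega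

/-- Four independent vertices that dominate `G`, linked by common neighbors in a path. -/
theorem hasAntimagicOrientation_of_dominating_path [Fintype V] [DecidableEq V] {G : SimpleGraph V}
    {x y z w c₁ c₂ c₃ : V} (hxy : x ≠ y) (hxz : x ≠ z) (hxw : x ≠ w) (hyz : y ≠ z) (hyw : y ≠ w)
    (hzw : z ≠ w) (hS : G.IsIndepSet ({x, y, z, w} : Finset V))
    (hdom : ∀ t ∉ ({x, y, z, w} : Finset V), ∃ s ∈ ({x, y, z, w} : Finset V), G.Adj s t)
    (hm : 4 * ({x, y, z, w} : Finset V)ᶜ.card < G.edgeSet.ncard)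
    (a₁ : G.Adj x c₁) (b₁ : G.Adj y c₁) (a₂ : G.Adj y c₂) (b₂ : G.Adj z c₂)
    (a₃ : G.Adj z c₃) (b₃ : G.Adj w c₃) (h₁₂ : c₁ ≠ c₂) (h₁₃ : c₁ ≠ c₃) (h₂₃ : c₂ ≠ c₃) :
    G.HasAntimagicOrientation := by
  obtain ⟨B, p, q, r, h1, h2, h3, h4, hAO⟩ := exists_three_transfers hS hdom hm
    (by simp) (by simp) (by simp) (by simp) (by simp) (by simp) hxy hyz hzw a₁ b₁ a₂ b₂ a₃ b₃
    h₁₂ h₁₃ h₂₃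
  by_contra hno
  refine not_forall_transfer_path (B x) (B y) (B z) (B w) p q r h1 h2 h3 h4 ?_
  intro e f g he hf hg
  by_contra hk
  push Not at hk
  refine hno (hAO (e == 1) (f == 1) (g == 1) ?_)
  apply Finset.injOn_four <;> rcases he with rfl | rfl <;> rcases hf with rfl | rfl <;>
    rcases hg with rfl | rfl <;>
    simp [transfer, hxy.symm, hxz.symm, hxw.symm, hyz.symm, hyw.symm, hzw.symm, *] at hk ⊢ <;> omega

/-- Four independent vertices that dominate `G`, linked by common neighbors in a star. -/
theorem hasAntimagicOrientation_of_dominating_star [Fintype V] [DecidableEq V] {G : SimpleGraph V}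
    {x y z w c₁ c₂ c₃ : V} (hxy : x ≠ y) (hxz : x ≠ z) (hxw : x ≠ w) (hyz : y ≠ z) (hyw : y ≠ w)
    (hzw : z ≠ w) (hS : G.IsIndepSet ({x, y, z, w} : Finset V))
    (hdom : ∀ t ∉ ({x, y, z, w} : Finset V), ∃ s ∈ ({x, y, z, w} : Finset V), G.Adj s t)
    (hm : 4 * ({x, y, z, w} : Finset V)ᶜ.card < G.edgeSet.ncard)
    (a₁ : G.Adj x c₁) (b₁ : G.Adj y c₁) (a₂ : G.Adj x c₂) (b₂ : G.Adj z c₂)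
    (a₃ : G.Adj x c₃) (b₃ : G.Adj w c₃) (h₁₂ : c₁ ≠ c₂) (h₁₃ : c₁ ≠ c₃) (h₂₃ : c₂ ≠ c₃) :
    G.HasAntimagicOrientation := by
  obtain ⟨B, p, q, r, h1, h2, h3, h4, hAO⟩ := exists_three_transfers hS hdom hm
    (by simp) (by simp) (by simp) (by simp) (by simp) (by simp) hxy hxz hxw a₁ b₁ a₂ b₂ a₃ b₃
    h₁₂ h₁₃ h₂₃
  by_contra hno
  refine not_forall_transfer_star (B x) (B y) (B z) (B w) p q r h1 h2 h3 h4 ?_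
  intro e f g he hf hg
  by_contra hk
  push Not at hk
  refine hno (hAO (e == 1) (f == 1) (g == 1) ?_)
  apply Finset.injOn_four <;> rcases he with rfl | rfl <;> rcases hf with rfl | rfl <;>
    rcases hg with rfl | rfl <;>
    simp [transfer, hxy.symm, hxz.symm, hxw.symm, hyz.symm, hyw.symm, hzw.symm, *] at hk ⊢ <;> omega

end SimpleGraph

-- Twelve choices: six arrangements of three labels, with or without a transfer. The unequal gaps
-- keep the label differences distinct, and `p` exceeds twice their spread.
set_option maxHeartbeats 4000000 in
theorem not_forall_perm_transfer (u v w y α β γ p : ℤ) (h1 : β < γ) (h2 : γ - β < β - α)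
    (h3 : 2 * (γ - α) < p)
    (H : ∀ e : ℤ, (e = 0 ∨ e = 1) → ∀ i j k,
      (i = α ∧ j = β ∧ k = γ ∨ i = α ∧ j = γ ∧ k = β ∨ i = β ∧ j = α ∧ k = γ ∨
        i = β ∧ j = γ ∧ k = α ∨ i = γ ∧ j = α ∧ k = β ∨ i = γ ∧ j = β ∧ k = α) →
      u + i = v + j ∨ u + i = w + k + e * p ∨ u + i = y - e * p ∨ v + j = w + k + e * p ∨
        v + j = y - e * p ∨ w + k + e * p = y - e * p) : False := by
  have H1 := H 0 (by simp) α β γ (by simp)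
  have H2 := H 0 (by simp) α γ β (by simp)
  have H3 := H 0 (by simp) β α γ (by simp)
  have H4 := H 0 (by simp) β γ α (by simp)
  have H5 := H 0 (by simp) γ α β (by simp)
  have H6 := H 0 (by simp) γ β α (by simp)
  have K1 := H 1 (by simp) α β γ (by simp)
  have K2 := H 1 (by simp) α γ β (by simp)
  have K3 := H 1 (by simp) β α γ (by simp)
  have K4 := H 1 (by simp) β γ α (by simp)
  have K5 := H 1 (by simp) γ α β (by simp)
  have K6 := H 1 (by simp) γ β α (by simp)
  clear H
  simp only [zero_mul, one_mul] at *
  rcases H1 with H1 | H1 | H1 | H1 | H1 | H1 <;> rcases K1 with H8 | H8 | H8 | H8 | H8 | H8 <;> omega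

namespace SimpleGraph

variable {V : Type*}

/-- Four independent vertices that dominate `G`, three of them with a common neighbor, and the
fourth linked to one of these. -/
theorem hasAntimagicOrientation_of_dominating_three_common [Fintype V] [DecidableEq V]
    {G : SimpleGraph V} {u v w y c d : V} (huv : u ≠ v) (huw : u ≠ w) (huy : u ≠ y) (hvw : v ≠ w)
    (hvy : v ≠ y) (hwy : w ≠ y) (hS : G.IsIndepSet ({u, v, w, y} : Finset V))
    (hdom : ∀ t ∉ ({u, v, w, y} : Finset V), ∃ s ∈ ({u, v, w, y} : Finset V), G.Adj s t)
    (hm : 5 * ({u, v, w, y} : Finset V)ᶜ.card + 2 < G.edgeSet.ncard)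
    (hu : G.Adj u c) (hv : G.Adj v c) (hw : G.Adj w c) (hdw : G.Adj w d) (hdy : G.Adj y d) :
    G.HasAntimagicOrientation := by
  by_cases hy : G.Adj y c
  · exact hasAntimagicOrientation_of_common_adj (by simp) hS hdom (c := c) (by simp [*])
  have hcd : c ≠ d := fun h => hy (h ▸ hdy)
  have hout : ∀ c, ∀ s ∈ ({u, v, w, y} : Finset V), G.Adj s c → c ∉ ({u, v, w, y} : Finset V) :=
    fun c s hs hsc hc => hS hs hc hsc.ne hsc
  set k := ({u, v, w, y} : Finset V)ᶜ.card with hk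
  obtain ⟨h, R, hP, hF, -, hAO⟩ := exists_labels_of_dominating_of_perm hS hdom (C := {c, d})
    (ψ := fun t => if t = d then y else w)
    (by
      simp only [Finset.mem_insert, Finset.mem_singleton, forall_eq_or_imp, forall_eq, if_true,
        if_neg hcd]
      exact ⟨⟨by simpa using hout c u (by simp) hu, by simp, hw⟩,
        ⟨by simpa using hout d y (by simp) hdy, by simp, hdy⟩⟩)
    (P := {(u, c), (v, c), (w, d)}) (by simp [*])
    -- The label at `(w, c)` lies in `(m - k, m]`, so the gaps at `c` are `k + 1` and at most `k`.
    -- Twice the spread is at most `4k + 2`, while the transfer at `d` is at least `m - k`; this is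
    -- where `5k + 2 < m` comes from.
    (ex := fun p => if p.2 = d then 1 else if p.1 = u then G.edgeSet.ncard - 2 * k - 1
      else G.edgeSet.ncard - k)
    (by
      apply Finset.injOn_three <;> simp only [if_true, if_neg hcd, if_neg huv.symm] <;> omega)
    (by
      simp only [Finset.mem_insert, Finset.mem_singleton, forall_eq_or_imp, forall_eq, if_true,
        if_neg hcd, if_neg huv.symm]
      omega)
  have e1 := hP (u, c) (by simp)
  have e2 := hP (v, c) (by simp)
  have e3 := hP (w, d) (by simp)
  have e4 := hF c (by simp)
  have e5 := hF d (by simp)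
  simp only [if_true, if_neg hcd, if_neg huv.symm] at e1 e2 e3 e4 e5
  have hperm : ∀ i j l : ℤ, (i = h u c ∧ j = h v c ∧ l = h w c ∨ i = h u c ∧ j = h w c ∧ l = h v c ∨
      i = h v c ∧ j = h u c ∧ l = h w c ∨ i = h v c ∧ j = h w c ∧ l = h u c ∨
      i = h w c ∧ j = h u c ∧ l = h v c ∨ i = h w c ∧ j = h v c ∧ l = h u c) →
      ∃ π : Equiv.Perm V, h (π u) c = i ∧ h (π v) c = j ∧ h (π w) c = l ∧ π y = y ∧
        ∀ s, (π s ∈ ({u, v, w, y} : Finset V) ∧ G.Adj (π s) c) ↔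
          (s ∈ ({u, v, w, y} : Finset V) ∧ G.Adj s c) := by
    have hs : ∀ a b : V, a ∈ ({u, v, w} : Finset V) → b ∈ ({u, v, w} : Finset V) → ∀ s,
        (Equiv.swap a b s ∈ ({u, v, w, y} : Finset V) ∧ G.Adj (Equiv.swap a b s) c) ↔
          (s ∈ ({u, v, w, y} : Finset V) ∧ G.Adj s c) := by
      intro a b ha hb
      refine swap_mem_iff (p := fun s => s ∈ ({u, v, w, y} : Finset V) ∧ G.Adj s c) ?_
      simp only [Finset.mem_insert, Finset.mem_singleton] at ha hb ⊢
      rcases ha with rfl | rfl | rfl <;> rcases hb with rfl | rfl | rfl <;> simp [*]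
    have hu' : u ∈ ({u, v, w} : Finset V) := by simp
    have hv' : v ∈ ({u, v, w} : Finset V) := by simp
    have hw' : w ∈ ({u, v, w} : Finset V) := by simp
    rintro i j l (⟨rfl, rfl, rfl⟩ | ⟨rfl, rfl, rfl⟩ | ⟨rfl, rfl, rfl⟩ | ⟨rfl, rfl, rfl⟩ |
      ⟨rfl, rfl, rfl⟩ | ⟨rfl, rfl, rfl⟩)
    · exact ⟨1, by simp⟩
    · refine ⟨Equiv.swap v w, ?_, ?_, ?_, ?_, hs v w hv' hw'⟩ <;>
        simp [Equiv.swap_apply_of_ne_of_ne, *, huv.symm, huw.symm, hvw.symm, huy.symm, hvy.symm,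
          hwy.symm]
    · refine ⟨Equiv.swap u v, ?_, ?_, ?_, ?_, hs u v hu' hv'⟩ <;>
        simp [Equiv.swap_apply_of_ne_of_ne, *, huv.symm, huw.symm, hvw.symm, huy.symm, hvy.symm,
          hwy.symm]
    · refine ⟨(Equiv.swap v w).trans (Equiv.swap u v), ?_, ?_, ?_, ?_,
        fun s => (hs u v hu' hv' _).trans (hs v w hv' hw' s)⟩ <;>
        simp [Equiv.swap_apply_of_ne_of_ne, *, huv.symm, huw.symm, hvw.symm, huy.symm, hvy.symm,
          hwy.symm]
    · refine ⟨(Equiv.swap u v).trans (Equiv.swap v w), ?_, ?_, ?_, ?_,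
        fun s => (hs v w hv' hw' _).trans (hs u v hu' hv' s)⟩ <;>
        simp [Equiv.swap_apply_of_ne_of_ne, *, huv.symm, huw.symm, hvw.symm, huy.symm, hvy.symm,
          hwy.symm]
    · refine ⟨Equiv.swap u w, ?_, ?_, ?_, ?_, hs u w hu' hw'⟩ <;>
        simp [Equiv.swap_apply_of_ne_of_ne, *, huv.symm, huw.symm, hvw.symm, huy.symm, hvy.symm,
          hwy.symm]
  by_contra hno
  refine not_forall_perm_transfer (R u + h u d) (R v + h v d) (R w + h w d) (R y + h y c + h y d)
    (h u c) (h v c) (h w c) (h y d - h w d) (by omega) (by omega) (by omega) ?_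
  intro e he i j l hijl
  obtain ⟨π, h1, h2, h3, h4, h5⟩ := hperm i j l hijl
  by_contra hk
  push Not at hk
  refine hno (hAO (fun t => if t = c then π else (if e = 1 then Equiv.swap w y else 1)) ?_ ?_)
  · simp only [Finset.mem_insert, Finset.mem_singleton, forall_eq_or_imp, forall_eq, if_true,
      if_neg hcd.symm]
    refine ⟨by simpa using h5, fun s => ?_⟩
    split_ifs
    · exact swap_mem_iff
        (p := fun s => (s = u ∨ s = v ∨ s = w ∨ s = y) ∧ G.Adj s d) (by simp [*]) s
    · simp
  · simp only [Finset.sum_pair hcd, if_true, if_neg hcd.symm]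
    apply Finset.injOn_four <;> rcases he with rfl | rfl <;>
      simp [h1, h2, h3, h4, Equiv.swap_apply_of_ne_of_ne, huw, huy, hvw, hvy] at hk ⊢ <;> omega

/-- A common neighbor. -/
def Linked (G : SimpleGraph V) (x y : V) : Prop := ∃ c, G.Adj x c ∧ G.Adj y c

theorem Linked.symm {G : SimpleGraph V} {x y : V} (h : G.Linked x y) : G.Linked y x :=
  let ⟨c, h1, h2⟩ := h
  ⟨c, h2, h1⟩

/-- Four independent vertices that dominate `G`, linked by common neighbors in a tree. -/
theorem hasAntimagicOrientation_of_dominating_four [Fintype V] [DecidableEq V] {G : SimpleGraph V}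
    {x y z w : V} (hxy : x ≠ y) (hxz : x ≠ z) (hxw : x ≠ w) (hyz : y ≠ z) (hyw : y ≠ w)
    (hzw : z ≠ w) (hS : G.IsIndepSet ({x, y, z, w} : Finset V))
    (hdom : ∀ t ∉ ({x, y, z, w} : Finset V), ∃ s ∈ ({x, y, z, w} : Finset V), G.Adj s t)
    (hm : 5 * ({x, y, z, w} : Finset V)ᶜ.card + 2 < G.edgeSet.ncard)
    (h1 : G.Linked x y) (h2 : G.Linked y z)
    (h3 : G.Linked z w ∨ G.Linked y w) : G.HasAntimagicOrientation := by
  set S : Finset V := {x, y, z, w} with hSdef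
  -- If three of the four share a neighbor, the previous lemma applies. Otherwise the vertices
  -- realizing the three links are distinct, and the three transfers are independent.
  have tri : ∀ a b c d : V, ({a, b, c, d} : Finset V) = S → a ≠ b → a ≠ c → a ≠ d → b ≠ c → b ≠ d →
      c ≠ d → G.Linked c d → ∀ t, G.Adj a t → G.Adj b t → G.Adj c t → G.HasAntimagicOrientation := by
    rintro a b c d hT hab hac had hbc hbd hcd ⟨e, hce, hde⟩ t hat hbt hct
    rw [← hT] at hS hdom hm
    exact hasAntimagicOrientation_of_dominating_three_common hab hac had hbc hbd hcd hS hdom hm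
      hat hbt hct hce hde
  by_contra hno
  have t1 : ∀ t, G.Adj y t → G.Adj z t → ¬ G.Adj w t := fun t a b c => hno <|
    tri z w y x (by grind) hzw hyz.symm hxz.symm hyw.symm hxw.symm hxy.symm h1.symm t b c a
  have t2 : ∀ t, G.Adj x t → G.Adj z t → ¬ G.Adj w t := fun t a b c => hno <|
    tri z w x y (by grind) hzw hxz.symm hyz.symm hxw.symm hyw.symm hxy h1 t b c a
  have t3 : ∀ t, G.Adj x t → G.Adj y t → ¬ G.Adj w t := fun t a b c => hno <|
    tri x w y z (by grind) hxw hxy hxz hyw.symm hzw.symm hyz h2 t a c b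
  have t4 : ∀ t, G.Adj x t → G.Adj y t → ¬ G.Adj z t := fun t a b c => hno <| by
    rcases h3 with h3 | h3
    · exact tri x y z w rfl hxy hxz hxw hyz hyw hzw h3 t a b c
    · exact tri x z y w (by grind) hxz hxy hxw hyz.symm hzw hyw h3 t a c b
  obtain ⟨c₁, a₁, b₁⟩ := h1
  obtain ⟨c₂, a₂, b₂⟩ := h2
  have h₁₂ : c₁ ≠ c₂ := by
    rintro rfl
    exact t4 _ a₁ b₁ b₂
  rcases h3 with ⟨c₃, a₃, b₃⟩ | ⟨c₃, a₃, b₃⟩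
  · refine hno (hasAntimagicOrientation_of_dominating_path hxy hxz hxw hyz hyw hzw hS hdom
      (by rw [← hSdef]; omega) a₁ b₁ a₂ b₂ a₃ b₃ h₁₂ ?_ ?_)
    · rintro rfl
      exact t4 _ a₁ b₁ a₃
    · rintro rfl
      exact t1 _ a₂ b₂ b₃
  · have hT : ({y, x, z, w} : Finset V) = S := by grind
    rw [← hT] at hS hdom hm
    refine hno (hasAntimagicOrientation_of_dominating_star hxy.symm hyz hyw hxz hxw hzw hS hdom
      (by omega) b₁ a₁ a₂ b₂ a₃ b₃ h₁₂ ?_ ?_)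
    · rintro rfl
      exact t3 _ a₁ b₁ b₃
    · rintro rfl
      exact t1 _ a₂ b₂ b₃

/-! ### Growing the dominating set, and counting edges. -/

/-- A walk from `z₀` to `S` leaves the set of undominated vertices. The vertex just after that exit
lies outside `S`, and it is the common neighbor. -/
theorem exists_linked_of_not_dominating {G : SimpleGraph V} (hG : G.Connected) {S : Finset V}
    (hne : S.Nonempty) {z₀ : V} (hz₀ : z₀ ∉ S) (hz₀S : ∀ s ∈ S, ¬ G.Adj s z₀) :
    ∃ z ∉ S, (∀ s ∈ S, ¬ G.Adj s z) ∧ ∃ x ∈ S, G.Linked x z := by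
  obtain ⟨x, hx⟩ := hne
  obtain ⟨p⟩ := hG.preconnected z₀ x
  obtain ⟨d, -, hd1, hd2⟩ := p.exists_boundary_dart {z | z ∉ S ∧ ∀ s ∈ S, ¬ G.Adj s z}
    ⟨hz₀, hz₀S⟩ (fun h => h.1 hx)
  have hsnd : d.snd ∉ S := fun h => hd1.2 _ h d.adj.symm
  have : ∃ s ∈ S, G.Adj s d.snd := by
    by_contra hh
    push Not at hh
    exact hd2 ⟨hsnd, hh⟩
  obtain ⟨s, hs, hsd⟩ := this
  exact ⟨d.fst, hd1.1, hd1.2, s, hs, d.snd, hsd, d.adj⟩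

theorem two_mul_ncard_edgeSet_ge [Fintype V] (G : SimpleGraph V) [DecidableRel G.Adj] {δ : ℕ}
    (h : δ ≤ G.minDegree) : δ * Fintype.card V ≤ 2 * G.edgeSet.ncard := by
  classical
  have h1 := G.sum_degrees_eq_twice_card_edges
  have h2 : ∑ v : V, δ ≤ ∑ v, G.degree v :=
    Finset.sum_le_sum fun v _ => h.trans (G.minDegree_le_degree v)
  rw [Finset.sum_const, Finset.card_univ, smul_eq_mul, mul_comm, h1] at h2
  rwa [← coe_edgeFinset, Set.ncard_coe_finset]

/-- The complement has no clique of size `4`, hence by Turán at most `n² / 3` edges, so `G` has at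
least `n² / 6 - n / 2`. This exceeds `2(n - 3)` exactly when `(n - 3)(n - 12) > 0`, whence the bound
`13`. -/
theorem ncard_edgeSet_gt_of_indepNum_le_three [Fintype V] (G : SimpleGraph V)
    (h : G.indepNum ≤ 3) (hV : 13 ≤ Fintype.card V) :
    2 * (Fintype.card V - 3) < G.edgeSet.ncard := by
  classical
  have hc : Gᶜ.CliqueFree 4 := by
    intro s hs
    rw [isNClique_compl] at hs
    have := hs.isIndepSet.card_le_indepNum
    have := hs.card_eq
    omega
  obtain ⟨H, _, maxH⟩ := exists_isTuranMaximal (V := V) (r := 3) (by norm_num)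
  have h1 : Gᶜ.edgeFinset.card ≤ H.edgeFinset.card := by convert maxH.2 hc
  have h2 := ((isTuranMaximal_iff_nonempty_iso_turanGraph (by norm_num)).mp maxH).some.card_edgeFinset_eq
  have h3 := mul_card_edgeFinset_turanGraph_le (n := Fintype.card V) (r := 3)
  have h4 : 2 * G.edgeFinset.card + 2 * Gᶜ.edgeFinset.card
      = Fintype.card V * (Fintype.card V - 1) := by
    rw [← sum_degrees_eq_twice_card_edges, ← sum_degrees_eq_twice_card_edges,
      ← Finset.sum_add_distrib, Finset.sum_congr rfl (g := fun _ => Fintype.card V - 1)]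
    · simp
    · intro v _
      rw [degree_compl]
      have := G.degree_lt_card_verts v
      omega
  rw [← coe_edgeFinset, Set.ncard_coe_finset]
  rw [← h2] at h3
  obtain ⟨n, hn⟩ := Nat.exists_eq_add_of_le hV
  rw [hn] at h3 h4 ⊢
  have h5 : 13 + n - 1 = 12 + n := by omega
  have h6 : 13 + n - 3 = 10 + n := by omega
  rw [h5] at h4
  rw [h6]
  nlinarith

end SimpleGraph

namespace SimpleGraph

variable {V : Type*}

theorem IsIndepSet.insert_finset [DecidableEq V] {G : SimpleGraph V} {S : Finset V}
    (hS : G.IsIndepSet S) {z : V} (hz : ∀ s ∈ S, ¬ G.Adj s z) :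
    G.IsIndepSet (insert z S : Finset V) := by
  intro a ha b hb hab
  rw [Finset.mem_coe, Finset.mem_insert] at ha hb
  rcases ha with rfl | ha <;> rcases hb with rfl | hb
  · exact (hab rfl).elim
  · exact fun h => hz b hb h.symm
  · exact hz a ha
  · exact hS ha hb hab

/-- The edge bounds are conditional because a dominating set of size `3` or `4` arises only if the
independence number is that large; sizes `1` and `2` need no bound. -/
theorem hasAntimagicOrientation_of_indepNum_le_four [Fintype V] {G : SimpleGraph V}
    (hG : G.Connected) (h4 : G.indepNum ≤ 4)
    (hm3 : 3 ≤ G.indepNum → 2 * (Fintype.card V - 3) < G.edgeSet.ncard)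
    (hm4 : 4 ≤ G.indepNum → 5 * (Fintype.card V - 4) + 2 < G.edgeSet.ncard) :
    G.HasAntimagicOrientation := by
  classical
  by_contra hno
  have step : ∀ S : Finset V, S.Nonempty → G.IsIndepSet S →
      (∀ t ∉ S, ∃ s ∈ S, G.Adj s t) ∨
        ∃ z, z ∉ S ∧ G.IsIndepSet (insert z S : Finset V) ∧ ∃ x ∈ S, G.Linked x z := by
    intro S hne hS
    by_cases hdom : ∀ t ∉ S, ∃ s ∈ S, G.Adj s t
    · exact Or.inl hdom
    · push Not at hdom
      obtain ⟨t, ht, htS⟩ := hdom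
      obtain ⟨z, hz, hzS, h⟩ := exists_linked_of_not_dominating hG hne ht htS
      exact Or.inr ⟨z, hz, hS.insert_finset hzS, h⟩
  obtain ⟨x⟩ := hG.nonempty
  rcases step {x} (by simp) (by simp) with hdom | ⟨y, hy, hS2, x', hx', hxy⟩
  · exact hno (hasAntimagicOrientation_of_dominating_singleton (v := x) (by simpa using hdom))
  rw [Finset.mem_singleton] at hx' hy
  subst hx'
  rcases step _ (by simp) hS2 with hdom | ⟨z, hz, hS3, y', hy', hyz⟩
  · obtain ⟨c, hcx, hcy⟩ := hxy
    exact hno (hasAntimagicOrientation_of_common_adj (by simp) hS2 hdom (c := c) (by simp [*]))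
  -- Two links on three vertices form a path; its middle vertex is named `b`.
  obtain ⟨a, b, hab, hbz, habl, hS3'⟩ : ∃ a b, a ≠ b ∧ G.Linked b z ∧ G.Linked a b ∧
      ({y, x'} : Finset V) = {a, b} := by
    simp only [Finset.mem_insert, Finset.mem_singleton] at hy'
    rcases hy' with rfl | rfl
    · exact ⟨x', y', Ne.symm hy, hyz, hxy, Finset.pair_comm _ _⟩
    · exact ⟨y, y', hy, hyz, hxy.symm, rfl⟩
  rw [hS3'] at hz hS3
  simp only [Finset.mem_insert, Finset.mem_singleton, not_or] at hz
  have haz : a ≠ z := Ne.symm hz.1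
  have hbz' : b ≠ z := Ne.symm hz.2
  have e3 : (insert z {a, b} : Finset V) = {a, b, z} := by grind
  rw [e3] at hS3
  have c3 : ({a, b, z} : Finset V).card = 3 := Finset.card_eq_three.2 ⟨a, b, z, hab, haz, hbz', rfl⟩
  have hi3 := hS3.card_le_indepNum
  rcases step _ (by simp) hS3 with hdom | ⟨w, hw, hS4, u, hu, huw⟩
  · refine hno (hasAntimagicOrientation_of_dominating_three hab haz hbz' hS3 hdom habl hbz ?_)
    rw [Finset.card_compl, c3]
    exact hm3 (by omega)
  -- A tree on four vertices is a path or a star. The names are chosen so that `w` hangs from the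
  -- end `r` or from the middle `q`.
  obtain ⟨p, q, r, hpq, hpr, hqr, l1, l2, l3, hT⟩ : ∃ p q r, p ≠ q ∧ p ≠ r ∧ q ≠ r ∧ G.Linked p q ∧
      G.Linked q r ∧ (G.Linked r w ∨ G.Linked q w) ∧ ({a, b, z} : Finset V) = {p, q, r} := by
    simp only [Finset.mem_insert, Finset.mem_singleton] at hu
    rcases hu with rfl | rfl | rfl
    · exact ⟨z, b, u, hbz'.symm, haz.symm, hab.symm, hbz.symm, habl.symm, Or.inl huw, by grind⟩
    · exact ⟨a, u, z, hab, haz, hbz', habl, hbz, Or.inr huw, rfl⟩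
    · exact ⟨a, b, u, hab, haz, hbz', habl, hbz, Or.inl huw, rfl⟩
  rw [hT] at hw hS4
  simp only [Finset.mem_insert, Finset.mem_singleton, not_or] at hw
  have e4 : (insert w {p, q, r} : Finset V) = {p, q, r, w} := by grind
  rw [e4] at hS4
  have c4 : ({p, q, r, w} : Finset V).card = 4 := by
    rw [Finset.card_eq_succ]
    exact ⟨p, {q, r, w}, by grind, rfl, Finset.card_eq_three.2
      ⟨q, r, w, hqr, Ne.symm hw.2.1, Ne.symm hw.2.2, rfl⟩⟩
  have hi4 := hS4.card_le_indepNum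
  rcases step _ (by simp) hS4 with hdom | ⟨v, hv, hS5, -⟩
  · refine hno (hasAntimagicOrientation_of_dominating_four hpq hpr (Ne.symm hw.1) hqr
      (Ne.symm hw.2.1) (Ne.symm hw.2.2) hS4 hdom ?_ l1 l2 l3)
    rw [Finset.card_compl, c4]
    exact hm4 (by omega)
  · have := hS5.card_le_indepNum
    rw [Finset.card_insert_of_notMem hv] at this
    omega

end SimpleGraph

theorem theorem1p5 {V : Type*} [Fintype V] (G : SimpleGraph V) [DecidableRel G.Adj]
    (hG : G.Connected) :
    (G.indepNum ≤ 2 → G.HasAntimagicOrientation) ∧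
    (G.indepNum = 3 → 13 ≤ Fintype.card V → G.HasAntimagicOrientation) ∧
    (G.indepNum = 4 → 11 ≤ G.minDegree → G.HasAntimagicOrientation) := by
  refine ⟨fun h => ?_, fun h hV => ?_, fun h hδ => ?_⟩
  · exact SimpleGraph.hasAntimagicOrientation_of_indepNum_le_four hG (by omega)
      (fun _ => by omega) (fun _ => by omega)
  · exact SimpleGraph.hasAntimagicOrientation_of_indepNum_le_four hG (by omega)
      (fun _ => G.ncard_edgeSet_gt_of_indepNum_le_three h.le hV) (fun _ => by omega)
  · have h1 := G.two_mul_ncard_edgeSet_ge hδ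
    have h2 : 0 < Fintype.card V := Fintype.card_pos_iff.mpr hG.nonempty
    exact SimpleGraph.hasAntimagicOrientation_of_indepNum_le_four hG h.le
      (fun _ => by omega) (fun _ => by omega)
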